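/- Let $\{x(n)\}_{n\in\mathbb Z}$ be a complex second-order process on a probability space which is cyclostationary with period $P\ge 1$: its autocorrelation $r(n,m)=\mathrm E[x(n+m)x^*(n)]$ satisfies $r(n+lP,m)=r(n,m)$ for all integers $n,m,l$. Assume $\sum_{m}|r(n,m)|<\infty$ for every $n$, so that the cyclic spectrum $$S^{(k/P)}(f)=\frac1P\sum_{n=0}^{P-1}\sum_{m\in\mathbb Z} r(n,m)e^{-j2\pi(kn/P+fm)},\qquad k\in\mathbb Z,$$ is defined. For $\sigma\in[0,1/P)$ let $\mathbf S(\sigma)$ be the $P\times P$ cyclic PSD matrix with entries $[\mathbf S(\sigma)]_{r,c}=S^{((r-c)/P)}(\sigma+r/P)$, $0\le r,c\le P-1$, and let $\mathbf B(\sigma)=[\mathbf b^{(0)}(\sigma),\dots,\mathbf b^{(P-1)}(\sigma)]$ be unitary, measurable in $\sigma$, with $\mathbf S(\sigma)\mathbf b^{(p)}(\sigma)=\mathcal S^{(p)}(\sigma)\mathbf b^{(p)}(\sigma)$, $\mathcal S^{(p)}(\sigma)\in\mathbb R$. Put, for $\sigma\in[0,1/P)$ and $0\le p\le P-1$, $$\phi(n,\sigma+\tfrac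 pP)=\sum_{q=0}^{P-1}b^{(p)}(q,\sigma)e^{j2\pi(\sigma+q/P)n},\qquad \mathcal S(\sigma+\tfrac pP)=\mathcal S^{(p)}(\sigma).$$ For functions $\theta(n,\lambda)$ on $[0,1)$, a spectral process of $x$ with respect to $\theta$ is a countably additive measure $\eta$ on the Borel sets, carried by $[0,1)$, with values in the space $L^2$ of random variables, such that $x(n)=\int_0^1\theta(n,\lambda)\,d\eta(\lambda)$ for all $n$ and, in mean square (with $N$ even), $$\eta(A)=\lim_{N\to\infty}\sum_{n=-N/2}^{N/2-1}x(n)\int_A\theta^*(n,\lambda)\,d\lambda,\qquad \eta(\{\lambda\})=\lim_{N\to\infty}\frac1N\sum_{n=-N/2}^{N/2-1}x(n)\theta^*(n,\lambda)$$ for all Borel sets $A\subseteq[0,1)$ and all $\lambda\in[0,1)$. Then: (i) $x$ has exactly one Cramér–Loève spectral process $\nu$, that is, one spectral process with respect to $\theta(n,f)=e^{j2\pi fn}$. (ii) $\phi$ is a Karhunen–Loève eigenbasis with spectrum $\mathcal S$: $\int_0^1\phi(n,\lambda)\phi^*(n',\lambda)\,d\lambda=\delta_{n-n'}$; $\sum_n\phi(n,\lambda)\phi^*(n,\lambda')=\delta(\lambda-\lambda')$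 when tested against $L^2$ functions of $\lambda$ and of $\lambda'$; and $\sum_l r(l,k-l)\phi(l,\lambda)=\mathcal S(\lambda)\phi(k,\lambda)$ for all $k$ and all $\lambda\in[0,1)$. The spectrum $\mathcal S$ is integrable on $[0,1)$, and $x$ has exactly one Karhunen–Loève spectral process $\xi$, that is, one spectral process with respect to $\phi$ with orthogonal increments: $\mathrm E[\xi(A)\xi(A')^*]=\int_{A\cap A'}\mathcal S(\lambda)\,d\lambda$ for Borel sets $A,A'\subseteq[0,1)$. (iii) With $d\nu^{(p)}(\sigma)=d\nu(\sigma+p/P)$, $d\xi^{(p)}(\sigma)=d\xi(\sigma+p/P)$, $\breve{\mathbf x}=[d\nu^{(0)},\dots,d\nu^{(P-1)}]^T$ and $\widetilde{\mathbf x}=[d\xi^{(0)},\dots,d\xi^{(P-1)}]^T$, we have $$\widetilde{\mathbf x}(\sigma)=\mathbf B(\sigma)^H\breve{\mathbf x}(\sigma),\qquad \sigma\in[0,1/P),$$ that is, $\xi^{(p)}(A)=\sum_{q=0}^{P-1}\int_A b^{(p)}(q,\sigma)^*\,d\nu^{(q)}(\sigma)$ for every $p$ and every Borel set $A\subseteq[0,1/P)$.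 -/

import Mathlib

open MeasureTheory Filter Topology Set
open scoped ComplexConjugate ENNReal Matrix

noncomputable section

namespace CycloKL

/-- The complex exponential `e^{j 2 π f n}`. -/
def expo (n : ℤ) (f : ℝ) : ℂ :=
  Complex.exp (2 * (Real.pi : ℂ) * Complex.I * (f : ℂ) * (n : ℂ))

/-! ### Second-order and cyclostationary processes -/

section Autocorrelation

variable {Ω : Type*} [MeasurableSpace Ω]

/-- The autocorrelation function `R(n, m) = E[x(n+m) x*(n)]`. -/
def autocorr (μ : Measure Ω) (x : ℤ → Ω → ℂ) (n m : ℤ) : ℂ :=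
  ∫ ω, x (n + m) ω * conj (x n ω) ∂μ

/-- A (wide-sense) cyclostationary process of period `P`: a second-order process whose
autocorrelation is `P`-periodic in time. -/
structure IsCyclostationary (μ : Measure Ω) (x : ℤ → Ω → ℂ) (P : ℕ) : Prop where
  secondOrder : ∀ n, MemLp (x n) 2 μ
  periodic : ∀ n m l : ℤ, autocorr μ x (n + l * (P : ℤ)) m = autocorr μ x n m

/-- The process as a sequence of elements of the Hilbert space of second-order random
variables; convergence there is mean-square convergence. -/
def toL2 {μ : Measure Ω} {x : ℤ → Ω → ℂ} (hx : ∀ n, MemLp (x n) 2 μ) (n : ℤ) : Lp ℂ 2 μ :=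
  (hx n).toLp (x n)

/-- The cyclic spectrum at cycle frequency `k / P`:
`(1/P) ∑_{n=0}^{P-1} ∑_{m ∈ ℤ} R(n, m) e^{-j 2 π (k n / P + f m)}`. -/
def cyclicSpectrum (μ : Measure Ω) (x : ℤ → Ω → ℂ) (P : ℕ) (k : ℤ) (f : ℝ) : ℂ :=
  (1 / (P : ℂ)) * ∑ n ∈ Finset.range P, ∑' m : ℤ,
    autocorr μ x (n : ℤ) m *
      Complex.exp (-(2 * (Real.pi : ℂ) * Complex.I *
        ((k : ℂ) * (n : ℂ) / (P : ℂ) + (f : ℂ) * (m : ℂ))))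

/-- The cyclic PSD matrix: entry `(r, c)` is the cyclic spectrum at cycle frequency
`(r - c) / P` and frequency `σ + r / P`. -/
def cyclicPSD (μ : Measure Ω) (x : ℤ → Ω → ℂ) (P : ℕ) (σ : ℝ) : Matrix (Fin P) (Fin P) ℂ :=
  Matrix.of fun r c =>
    cyclicSpectrum μ x P (((r : ℕ) : ℤ) - ((c : ℕ) : ℤ)) (σ + ((r : ℕ) : ℝ) / (P : ℝ))

end Autocorrelation

/-! ### Integration of bounded functions against a Hilbert-space-valued measure -/

section Integral

variable {H : Type*} [NormedAddCommGroup H] [NormedSpace ℂ H]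

/-- Integral over `A` of a simple function. -/
def simpleIntegral (η : VectorMeasure ℝ H) (A : Set ℝ) (s : SimpleFunc ℝ ℂ) : H :=
  ∑ c ∈ s.range, c • η (A ∩ s ⁻¹' {c})

/-- `y = ∫_A f dη`, for `f` a uniform limit on `A` of simple functions (that is, bounded and
measurable): the integrals of simple functions that approximate `f` uniformly on `A`
converge to `y`. -/
def HasIntegral (η : VectorMeasure ℝ H) (A : Set ℝ) (f : ℝ → ℂ) (y : H) : Prop :=
  (∀ δ > (0 : ℝ), ∃ s : SimpleFunc ℝ ℂ, ∀ t ∈ A, ‖s t - f t‖ < δ) ∧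
  ∀ ε > (0 : ℝ), ∃ δ > (0 : ℝ), ∀ s : SimpleFunc ℝ ℂ,
    (∀ t ∈ A, ‖s t - f t‖ < δ) → ‖simpleIntegral η A s - y‖ < ε

/-- The spectral process on the sub-band of index `p`: its increment at `σ` is the increment
of `η` at `σ + p / P`. -/
def band (P : ℕ) (η : VectorMeasure ℝ H) (p : Fin P) : VectorMeasure ℝ H :=
  η.map fun f => f - ((p : ℕ) : ℝ) / (P : ℝ)

/-- The equality `dζ(σ) = C(σ) dη(σ)` of vectors of increments on `D`: for every Borel set
`A ⊆ D`, `ζ_p(A) = ∑_q ∫_A C(σ)_{p,q} dη_q(σ)`. -/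
def IncrementsEq {P : ℕ} (D : Set ℝ) (ζ : Fin P → VectorMeasure ℝ H)
    (C : ℝ → Matrix (Fin P) (Fin P) ℂ) (η : Fin P → VectorMeasure ℝ H) : Prop :=
  ∀ p : Fin P, ∀ A : Set ℝ, MeasurableSet A → A ⊆ D →
    ∃ y : Fin P → H, (∀ q, HasIntegral (η q) A (fun σ => C σ p q) (y q)) ∧
      ζ p A = ∑ q, y q

/-- `η` is the spectral process on `[0, 1)` of `x` with respect to the functions `θ(n, λ)`. -/
structure IsSpectralProcess (x : ℤ → H) (θ : ℤ → ℝ → ℂ) (η : VectorMeasure ℝ H) : Prop where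
  support : ∀ A, MeasurableSet A → η A = η (A ∩ Ico 0 1)
  /-- Synthesis: `x(n) = ∫_0^1 θ(n, λ) dη(λ)`. -/
  synthesis : ∀ n, HasIntegral η (Ico 0 1) (θ n) (x n)
  /-- Analysis, as increments over sets (the weight `1 / N` becoming `dλ`):
  `η(A) = lim_N ∑_{n=-N/2}^{N/2-1} x(n) ∫_A θ*(n, λ) dλ`, with `N = 2 M`. -/
  analysis : ∀ A, MeasurableSet A → A ⊆ Ico 0 1 →
    Tendsto (fun M : ℕ => ∑ n ∈ Finset.Ico (-(M : ℤ)) (M : ℤ),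
      (∫ t in A, conj (θ n t)) • x n) atTop (𝓝 (η A))
  /-- Analysis at a point: `η({λ}) = lim_N (1/N) ∑_{n=-N/2}^{N/2-1} x(n) θ*(n, λ)`,
  with `N = 2 M`. -/
  analysis_point : ∀ t ∈ Ico (0 : ℝ) 1,
    Tendsto (fun M : ℕ => (1 / (2 * (M : ℂ))) • ∑ n ∈ Finset.Ico (-(M : ℤ)) (M : ℤ),
      conj (θ n t) • x n) atTop (𝓝 (η {t}))

end Integral

/-! ### Karhunen-Loève basis and expansion -/

/-- `φ(n, λ)`, `λ ∈ [0, 1)`, is a Karhunen-Loève eigenbasis for the autocorrelation `R`, with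
spectrum `S(λ)`. -/
structure IsKLBasis (R : ℤ → ℤ → ℂ) (φ : ℤ → ℝ → ℂ) (S : ℝ → ℝ) : Prop where
  memLp : ∀ n, MemLp (φ n) 2 (volume.restrict (Ico (0 : ℝ) 1))
  /-- `∫_0^1 φ(n, λ) φ*(n', λ) dλ = δ_{n-n'}`. -/
  orthonormal : ∀ n n' : ℤ,
    ∫ t in Ico (0 : ℝ) 1, φ n t * conj (φ n' t) = if n = n' then 1 else 0
  /-- `∑_n φ(n, λ) φ*(n, λ') = δ(λ - λ')`, tested against `g*(λ)` and `h(λ')`. -/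
  complete : ∀ g h : ℝ → ℂ, MemLp g 2 (volume.restrict (Ico (0 : ℝ) 1)) →
    MemLp h 2 (volume.restrict (Ico (0 : ℝ) 1)) →
    HasSum (fun n : ℤ => (∫ t in Ico (0 : ℝ) 1, conj (g t) * φ n t) *
      ∫ t in Ico (0 : ℝ) 1, conj (φ n t) * h t) (∫ t in Ico (0 : ℝ) 1, conj (g t) * h t)
  /-- `∑_l R(l, k - l) φ(l, λ) = S(λ) φ(k, λ)`. -/
  eigen : ∀ t ∈ Ico (0 : ℝ) 1, ∀ k : ℤ,
    HasSum (fun l : ℤ => R l (k - l) * φ l t) ((S t : ℂ) * φ k t)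

section Expansions

variable {Ω : Type*} [MeasurableSpace Ω] {μ : Measure Ω}

/-- `ν` is the Cramér-Loève spectral process of the second-order process `x`. -/
def IsCLExpansion {x : ℤ → Ω → ℂ} (hx : ∀ n, MemLp (x n) 2 μ)
    (ν : VectorMeasure ℝ (Lp ℂ 2 μ)) : Prop :=
  IsSpectralProcess (toL2 hx) expo ν

/-- `ξ` is the Karhunen-Loève spectral process of the second-order process `x` for the
Karhunen-Loève eigenbasis `φ` with spectrum `S`; it has orthogonal increments. -/
structure IsKLExpansion {x : ℤ → Ω → ℂ} (hx : ∀ n, MemLp (x n) 2 μ)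
    (φ : ℤ → ℝ → ℂ) (S : ℝ → ℝ) (ξ : VectorMeasure ℝ (Lp ℂ 2 μ)) : Prop where
  basis : IsKLBasis (autocorr μ x) φ S
  spectral : IsSpectralProcess (toL2 hx) φ ξ
  integrable : IntegrableOn S (Ico 0 1)
  /-- `E[dξ(λ) dξ*(λ')] = S(λ) δ(λ - λ') dλ dλ'`. -/
  orthogonal : ∀ A A' : Set ℝ, MeasurableSet A → MeasurableSet A' →
    A ⊆ Ico 0 1 → A' ⊆ Ico 0 1 →
    ∫ ω, ξ A ω * conj (ξ A' ω) ∂μ = ∫ t in A ∩ A', (S t : ℂ)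

end Expansions

/-! ### The basis of a cyclostationary process -/

/-- The function of `λ ∈ [0, 1)` whose value at `λ = σ + p / P`, with `σ ∈ [0, 1/P)`, is
`g p σ`. -/
def joinBands {E : Type*} [AddCommMonoid E] (P : ℕ) (g : Fin P → ℝ → E) (t : ℝ) : E :=
  ∑ p : Fin P, (Ico (((p : ℕ) : ℝ) / P) ((((p : ℕ) : ℝ) + 1) / P)).indicator
    (fun t => g p (t - ((p : ℕ) : ℝ) / P)) t

/-- `φ(n, σ + p / P) = ∑_q b^{(p)}(q, σ) e^{j 2 π (σ + q / P) n}`, where `b^{(p)}(σ)` is the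
column of index `p` of `B(σ)`. -/
def csBasis (P : ℕ) (B : ℝ → Matrix (Fin P) (Fin P) ℂ) (n : ℤ) : ℝ → ℂ :=
  joinBands P fun p σ => ∑ q : Fin P, B σ q p * expo n (σ + ((q : ℕ) : ℝ) / P)

end CycloKL

end

/-! ### Integration against the vector measure of a bounded operator on L² -/

namespace CycloKL

/-! The inner products of the process are `⟨x n, x m⟩ = r(n, m - n)`. Summability in the lag and
periodicity in time bound the row sums of this Gram matrix uniformly, so Schur's test gives `‖∑ c n
• x n‖² ≤ C ∑ ‖c n‖²`. Hence every Hilbert basis `θ n` of `L²[0,1)` has a bounded synthesis operator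
`Φ g = ∑ ⟨θ n, g⟩ x n` with `Φ (θ n) = x n`. The measure `η A = Φ 1_A` is countably additive and
integrates bounded measurable `f` to `Φ f`. For uniformly bounded `θ` this is a spectral process
(`exists_isSpectralProcess`), and the analysis formula makes it the only one. Both expansions thus
reduce to finding a basis.

For the Cramér–Loève process the basis is the Fourier basis. For `φ`, the operator that applies the
conjugate of `B σ` across the `P` bands preserves inner products of `L²[0,1)` and sends `φ n` to the
exponential `expo n` (`mixBands_csBasis`), so orthonormality and completeness are inherited from
Fourier series. The kernel `r(l, k - l)` maps the exponential of band `q` to the combination of the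
exponentials of all bands given by column `q` of the cyclic PSD matrix (`hasSum_autocorr_mul_expo`),
so eigenvectors of the matrix become eigenfunctions of the kernel. The eigenequation and Parseval's
identity in the basis `φ` yield the orthogonal increments.

For the relation between the two processes, both sides are series in the `x n`, and their
coefficients agree by the definition of `φ`. -/

theorem exists_simpleFunc_norm_sub_lt {f : ℝ → ℂ} (hf : Measurable f) {A : Set ℝ} {C : ℝ}
    (hC : ∀ t ∈ A, ‖f t‖ ≤ C) {δ : ℝ} (hδ : 0 < δ) :
    ∃ s : SimpleFunc ℝ ℂ, ∀ t ∈ A, ‖s t - f t‖ < δ := by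
  let e := TopologicalSpace.denseSeq ℂ
  have hcov : Metric.closedBall (0 : ℂ) C ⊆ ⋃ k, Metric.ball (e k) δ := by
    intro z _
    obtain ⟨k, hk⟩ := (TopologicalSpace.denseRange_denseSeq ℂ).exists_dist_lt z hδ
    exact mem_iUnion.2 ⟨k, hk⟩
  obtain ⟨F, hF⟩ := (isCompact_closedBall (0 : ℂ) C).elim_finite_subcover _
    (fun k => Metric.isOpen_ball) hcov
  -- Rounding to the nearest among the points up to the largest index of the finite subcover is at
  -- least as good as rounding within the subcover.
  refine ⟨(SimpleFunc.nearestPt e (F.sup id)).comp f hf, fun t ht => ?_⟩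
  have hm : f t ∈ Metric.closedBall (0 : ℂ) C := by simpa using hC t ht
  obtain ⟨k, hk, hkt⟩ := mem_iUnion₂.1 (hF hm)
  have h1 := SimpleFunc.edist_nearestPt_le e (f t) (Finset.le_sup (f := id) hk)
  rw [← dist_eq_norm]
  rw [edist_dist, edist_dist, ENNReal.ofReal_le_ofReal_iff dist_nonneg] at h1
  rw [Metric.mem_ball, dist_comm] at hkt
  exact h1.trans_lt hkt

section L2

variable {H : Type*} [NormedAddCommGroup H] [NormedSpace ℂ H]
  (ρ : Measure ℝ) [IsFiniteMeasure ρ]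

/-- The class in `L²(ρ)` of the indicator function of `A`. -/
noncomputable def indL2 {A : Set ℝ} (hA : MeasurableSet A) : Lp ℂ 2 ρ :=
  indicatorConstLp 2 hA (measure_ne_top ρ A) (1 : ℂ)

/-- Partial sums are indicators of finite unions, and since `ρ` is finite the measure of what they
miss tends to zero. This is the countable additivity of `ofL2`. -/
theorem hasSum_indL2 {f : ℕ → Set ℝ} (hf : ∀ i, MeasurableSet (f i))
    (hd : Pairwise (Function.onFun Disjoint f)) :
    HasSum (fun i => indL2 ρ (hf i)) (indL2 ρ (MeasurableSet.iUnion hf)) := by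
  have hsum : ∀ F : Finset ℕ, ∑ i ∈ F, indL2 ρ (hf i) =
      indL2 ρ (F.measurableSet_biUnion fun i _ => hf i) := by
    intro F
    induction F using Finset.induction_on with
    | empty => simp [indL2]
    | insert a F ha ih =>
      rw [Finset.sum_insert ha, ih]
      have hdis : Disjoint (f a) (⋃ i ∈ F, f i) := by
        rw [disjoint_iUnion₂_right]
        intro i hi
        exact hd (fun h => ha (h ▸ hi))
      have := indicatorConstLp_disjoint_union (p := 2) (μ := ρ) (hf a)
        (F.measurableSet_biUnion fun i _ => hf i) (measure_ne_top ρ _) (measure_ne_top ρ _)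
        hdis (1 : ℂ)
      unfold indL2
      rw [← this]
      congr 1
      ext; simp
  unfold HasSum
  simp_rw [hsum]
  refine tendsto_indicatorConstLp_set (by simp) ?_
  have h1 : Tendsto (fun F : Finset ℕ => ρ (⋃ i ∈ F, f i)) atTop (𝓝 (ρ (⋃ i, f i))) := by
    have h : ∀ F : Finset ℕ, ρ (⋃ i ∈ F, f i) = ∑ i ∈ F, ρ (f i) := fun F =>
      measure_biUnion_finset (fun i _ j _ hij => hd hij) fun i _ => hf i
    simp_rw [h, measure_iUnion hd hf]
    exact ENNReal.summable.hasSum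
  have h2 : ∀ F : Finset ℕ, ρ (symmDiff (⋃ i ∈ F, f i) (⋃ i, f i)) =
      ρ (⋃ i, f i) - ρ (⋃ i ∈ F, f i) := by
    intro F
    have hs : (⋃ i ∈ F, f i) ⊆ ⋃ i, f i := iUnion₂_subset_iUnion _ _
    rw [symmDiff_of_le hs, ← measure_sdiff hs
      (F.measurableSet_biUnion fun i _ => hf i).nullMeasurableSet (measure_ne_top ρ _)]
  simp_rw [h2]
  have := ENNReal.Tendsto.sub (tendsto_const_nhds (x := ρ (⋃ i, f i))) h1
    (Or.inl (measure_ne_top ρ _))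
  simpa using this

open Classical in
/-- The vector measure `A ↦ Φ(1_A)` of a bounded operator `Φ` on `L²(ρ)`. -/
noncomputable def ofL2 (Φ : Lp ℂ 2 ρ →L[ℂ] H) : VectorMeasure ℝ H where
  measureOf' A := if hA : MeasurableSet A then Φ (indL2 ρ hA) else 0
  empty' := by simp [indL2]
  not_measurable' A hA := by simp [hA]
  m_iUnion' f hf hd := by
    have := (hasSum_indL2 ρ hf hd).mapL Φ
    simpa [hf, MeasurableSet.iUnion hf] using this

theorem ofL2_apply (Φ : Lp ℂ 2 ρ →L[ℂ] H) {A : Set ℝ} (hA : MeasurableSet A) :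
    ofL2 ρ Φ A = Φ (indL2 ρ hA) := dif_pos hA

theorem memLp_indicator_of_bound {f : ℝ → ℂ} (hf : Measurable f) {A : Set ℝ}
    (hA : MeasurableSet A) {C : ℝ} (hC : ∀ t ∈ A, ‖f t‖ ≤ C) :
    MemLp (A.indicator f) 2 ρ := by
  refine MemLp.of_bound (hf.indicator hA).aestronglyMeasurable |C| (ae_of_all _ fun t => ?_)
  by_cases ht : t ∈ A
  · simpa [ht] using (hC t ht).trans (le_abs_self C)
  · simp [ht]

theorem simpleIntegral_ofL2 (Φ : Lp ℂ 2 ρ →L[ℂ] H) {A : Set ℝ} (hA : MeasurableSet A)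
    (s : SimpleFunc ℝ ℂ) (hs : MemLp (A.indicator s) 2 ρ) :
    simpleIntegral (ofL2 ρ Φ) A s = Φ (hs.toLp _) := by
  unfold simpleIntegral
  have hm : ∀ c, MeasurableSet (A ∩ s ⁻¹' {c}) := fun c => hA.inter (s.measurableSet_fiber c)
  simp_rw [ofL2_apply ρ Φ (hm _), ← map_smul, ← map_sum]
  congr 1
  apply Lp.ext
  refine EventuallyEq.trans ?_ (MemLp.coeFn_toLp hs).symm
  refine (Lp.coeFn_finsetSum _ _).trans ?_
  have h1 : ∀ c ∈ s.range, ∀ᵐ t ∂ρ, (c • indL2 ρ (hm c) : Lp ℂ 2 ρ) t =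
      (A ∩ s ⁻¹' {c}).indicator (fun _ => c) t := by
    intro c _
    filter_upwards [Lp.coeFn_smul c (indL2 ρ (hm c)),
      indicatorConstLp_coeFn (p := 2) (hs := hm c) (hμs := measure_ne_top ρ _) (c := (1 : ℂ))]
      with t h1 h2
    rw [h1, Pi.smul_apply, indL2, h2]
    by_cases ht : t ∈ A ∩ s ⁻¹' {c} <;> simp [ht]
  have h2 := (ae_ball_iff (s.range.countable_toSet)).2 h1
  filter_upwards [h2] with t ht
  rw [Finset.sum_apply, Finset.sum_congr rfl (fun c hc => ht c hc)]
  by_cases htA : t ∈ A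
  · rw [indicator_of_mem htA, Finset.sum_eq_single (s t)]
    · simp [htA]
    · intro b _ hb
      simp [htA, hb.symm]
    · intro h
      exact absurd (s.mem_range_self t) h
  · simp [htA]

/-- On a finite measure space, uniform closeness on `A` implies L² closeness of the restrictions to
`A`, with factor `ρ(univ)^(1/2)`, and `Φ` is bounded. -/
theorem hasIntegral_ofL2 (Φ : Lp ℂ 2 ρ →L[ℂ] H) {A : Set ℝ} (hA : MeasurableSet A)
    {f : ℝ → ℂ} (hf : Measurable f) {C : ℝ} (hC : ∀ t ∈ A, ‖f t‖ ≤ C)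
    (hm : MemLp (A.indicator f) 2 ρ) :
    HasIntegral (ofL2 ρ Φ) A f (Φ (hm.toLp _)) := by
  refine ⟨fun δ hδ => exists_simpleFunc_norm_sub_lt hf hC hδ, fun ε hε => ?_⟩
  set D : ℝ := ‖Φ‖ * (ρ.real univ) ^ (1 / 2 : ℝ) with hD
  have hD0 : 0 ≤ D := by positivity
  -- `D` is the Lipschitz constant from the uniform norm to `H`; adding 1 covers `D = 0` and makes
  -- the final inequality strict.
  refine ⟨ε / (D + 1), by positivity, fun s hs => ?_⟩
  have hsm : MemLp (A.indicator s) 2 ρ := by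
    refine memLp_indicator_of_bound ρ s.measurable hA (C := C + ε / (D + 1)) fun t ht => ?_
    calc ‖s t‖ = ‖f t + (s t - f t)‖ := by simp
      _ ≤ ‖f t‖ + ‖s t - f t‖ := norm_add_le _ _
      _ ≤ _ := add_le_add (hC t ht) (hs t ht).le
  rw [simpleIntegral_ofL2 ρ Φ hA s hsm, ← map_sub, ← MemLp.toLp_sub]
  refine (Φ.le_opNorm _).trans_lt ?_
  have hb : ‖(hsm.sub hm).toLp _‖ ≤ (ρ.real univ) ^ (1 / 2 : ℝ) * (ε / (D + 1)) := by
    have := Lp.norm_le_of_ae_bound (f := (hsm.sub hm).toLp _) (C := ε / (D + 1)) (by positivity)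
      (by
        filter_upwards [MemLp.coeFn_toLp (hsm.sub hm)] with t ht
        rw [ht, Pi.sub_apply]
        by_cases htA : t ∈ A
        · simpa [htA] using (hs t htA).le
        · simp only [htA, not_false_eq_true, indicator_of_notMem, sub_self, norm_zero]
          positivity)
    convert this using 2
    norm_num [measureUnivNNReal, Measure.real]
    rfl
  calc ‖Φ‖ * ‖(hsm.sub hm).toLp _‖ ≤ ‖Φ‖ * ((ρ.real univ) ^ (1 / 2 : ℝ) * (ε / (D + 1))) := by
        gcongr
    _ = D / (D + 1) * ε := by rw [hD]; ring
    _ < ε := by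
        have : D / (D + 1) < 1 := by rw [div_lt_one (by positivity)]; linarith
        nlinarith

end L2

end CycloKL

namespace CycloKL

/-! ### Bessel sequences and their synthesis operators -/

section Bessel

variable {H : Type*} [NormedAddCommGroup H] [InnerProductSpace ℂ H]

/-- Schur's test for the Gram matrix of `x`. -/
theorem norm_sum_smul_sq_le {x : ℤ → H} {C : ℝ}
    (hC : ∀ (n : ℤ) (F : Finset ℤ), ∑ m ∈ F, ‖inner ℂ (x n) (x m)‖ ≤ C)
    (c : ℤ → ℂ) (F : Finset ℤ) :
    ‖∑ n ∈ F, c n • x n‖ ^ 2 ≤ C * ∑ n ∈ F, ‖c n‖ ^ 2 := by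
  have h1 : ‖∑ n ∈ F, c n • x n‖ ^ 2 ≤
      ∑ n ∈ F, ∑ m ∈ F, ‖c n‖ * ‖c m‖ * ‖inner ℂ (x n) (x m)‖ := by
    calc ‖∑ n ∈ F, c n • x n‖ ^ 2
        = ‖inner ℂ (∑ n ∈ F, c n • x n) (∑ n ∈ F, c n • x n)‖ := by
          rw [inner_self_eq_norm_sq_to_K]; simp
      _ = ‖∑ n ∈ F, ∑ m ∈ F, inner ℂ (c n • x n) (c m • x m)‖ := by
          simp_rw [sum_inner, inner_sum]
      _ ≤ ∑ n ∈ F, ∑ m ∈ F, ‖inner ℂ (c n • x n) (c m • x m)‖ :=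
          (norm_sum_le _ _).trans (Finset.sum_le_sum fun n _ => norm_sum_le _ _)
      _ = _ := by
          simp_rw [inner_smul_left, inner_smul_right, norm_mul, RCLike.norm_conj, mul_assoc]
  have hsym : ∀ n m, ‖inner ℂ (x n) (x m)‖ = ‖inner ℂ (x m) (x n)‖ := fun n m =>
    norm_inner_symm _ _
  have h2 : ∑ n ∈ F, ∑ m ∈ F, ‖c n‖ * ‖c m‖ * ‖inner ℂ (x n) (x m)‖ ≤
      ∑ n ∈ F, ∑ m ∈ F, (‖c n‖ ^ 2 / 2 * ‖inner ℂ (x n) (x m)‖ +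
        ‖c m‖ ^ 2 / 2 * ‖inner ℂ (x m) (x n)‖) := by
    refine Finset.sum_le_sum fun n _ => Finset.sum_le_sum fun m _ => ?_
    rw [hsym m n, ← add_mul]
    refine mul_le_mul_of_nonneg_right ?_ (norm_nonneg _)
    nlinarith [sq_nonneg (‖c n‖ - ‖c m‖)]
  have h3 : ∑ n ∈ F, ∑ m ∈ F, (‖c n‖ ^ 2 / 2 * ‖inner ℂ (x n) (x m)‖ +
        ‖c m‖ ^ 2 / 2 * ‖inner ℂ (x m) (x n)‖) =
      ∑ n ∈ F, ‖c n‖ ^ 2 * ∑ m ∈ F, ‖inner ℂ (x n) (x m)‖ := by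
    simp_rw [Finset.sum_add_distrib]
    rw [Finset.sum_comm (f := fun n m => ‖c m‖ ^ 2 / 2 * ‖inner ℂ (x m) (x n)‖),
      ← Finset.sum_add_distrib]
    refine Finset.sum_congr rfl fun n _ => ?_
    rw [← Finset.mul_sum, ← add_mul, add_halves]
  rw [h3] at h2
  refine h1.trans (h2.trans ?_)
  rw [Finset.mul_sum]
  refine Finset.sum_le_sum fun n _ => ?_
  rw [mul_comm]
  exact mul_le_mul_of_nonneg_right (hC n F) (by positivity)

/-- Schur's bound carries the Cauchy criterion from `∑ ‖c n‖²` to the vector series. -/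
theorem summable_smul_of_sq [CompleteSpace H] {x : ℤ → H} {C : ℝ}
    (hC : ∀ (n : ℤ) (F : Finset ℤ), ∑ m ∈ F, ‖inner ℂ (x n) (x m)‖ ≤ C)
    {c : ℤ → ℂ} (hc : Summable fun n => ‖c n‖ ^ 2) : Summable fun n => c n • x n := by
  have hC0 : 0 ≤ C := by simpa using hC 0 ∅
  rw [summable_iff_vanishing_norm]
  intro ε hε
  obtain ⟨s, hs⟩ := summable_iff_vanishing_norm.1 hc (ε ^ 2 / (C + 1)) (by positivity)
  refine ⟨s, fun F hF => ?_⟩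
  have h1 := norm_sum_smul_sq_le hC c F
  have h2 := (le_abs_self _).trans_lt (hs F hF)
  rw [lt_div_iff₀ (by positivity)] at h2
  have h3 : 0 ≤ ∑ n ∈ F, ‖c n‖ ^ 2 := by positivity
  refine lt_of_pow_lt_pow_left₀ 2 hε.le (h1.trans_lt ?_)
  nlinarith

/-- The synthesis operator `g ↦ ∑ ⟨b n, g⟩ x n` of a Bessel sequence `x`. -/
theorem exists_synthesis [CompleteSpace H] {K : Type*} [NormedAddCommGroup K]
    [InnerProductSpace ℂ K] {x : ℤ → H} {C : ℝ}
    (hC : ∀ (n : ℤ) (F : Finset ℤ), ∑ m ∈ F, ‖inner ℂ (x n) (x m)‖ ≤ C)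
    (b : HilbertBasis ℤ ℂ K) :
    ∃ Φ : K →L[ℂ] H, ∀ g, HasSum (fun n => inner ℂ (b n) g • x n) (Φ g) := by
  have hC0 : 0 ≤ C := by simpa using hC 0 ∅
  have hsq : ∀ g, HasSum (fun n => ‖inner ℂ (b n) g‖ ^ 2) (‖g‖ ^ 2) := by
    intro g
    have h := (b.hasSum_inner_mul_inner g g).mapL Complex.reCLM
    convert h using 1
    · ext n
      rw [← inner_conj_symm g (b n), Complex.reCLM_apply, Complex.conj_mul', ← Complex.ofReal_pow,
        Complex.ofReal_re]
    · rw [Complex.reCLM_apply, ← inner_self_eq_norm_sq (𝕜 := ℂ)]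
      rfl
  have hs : ∀ g, Summable fun n => inner ℂ (b n) g • x n := fun g =>
    summable_smul_of_sq hC (hsq g).summable
  let T : K →ₗ[ℂ] H :=
    { toFun := fun g => ∑' n, inner ℂ (b n) g • x n
      map_add' := fun g h => by
        simp_rw [inner_add_right, add_smul]
        exact (hs g).tsum_add (hs h)
      map_smul' := fun a g => by
        simp_rw [inner_smul_right, mul_smul]
        exact (hs g).tsum_const_smul a }
  refine ⟨T.mkContinuous (Real.sqrt C) fun g => ?_, fun g => (hs g).hasSum⟩
  refine le_of_tendsto (hs g).hasSum.norm (Eventually.of_forall fun F => ?_)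
  refine le_of_sq_le_sq ?_ (by positivity)
  rw [mul_pow, Real.sq_sqrt hC0]
  refine (norm_sum_smul_sq_le hC _ F).trans ?_
  gcongr
  exact sum_le_hasSum F (fun n _ => by positivity) (hsq g)

end Bessel

/-! ### From a Hilbert basis to a spectral process -/

section Spectral

variable (ρ : Measure ℝ)

theorem inner_toLp {α : Type*} [MeasurableSpace α] (ρ : Measure α) {g h : α → ℂ}
    (hg : MemLp g 2 ρ) (hh : MemLp h 2 ρ) :
    inner ℂ (hg.toLp g) (hh.toLp h) = ∫ t, conj (g t) * h t ∂ρ := by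
  rw [L2.inner_def]
  refine integral_congr_ae ?_
  filter_upwards [hg.coeFn_toLp, hh.coeFn_toLp] with t h1 h2
  rw [h1, h2, RCLike.inner_apply, mul_comm]

theorem inner_toLp_indL2 [IsFiniteMeasure ρ] {g : ℝ → ℂ} (hg : MemLp g 2 ρ)
    {A : Set ℝ} (hA : MeasurableSet A) :
    inner ℂ (hg.toLp g) (indL2 ρ hA) = ∫ t in A, conj (g t) ∂ρ := by
  rw [indL2, ← inner_conj_symm, L2.inner_indicatorConstLp_one, ← integral_conj]
  refine integral_congr_ae ?_
  filter_upwards [ae_restrict_of_ae hg.coeFn_toLp] with t h1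
  rw [h1]

/-- The completeness relation, tested on both sides with a vector orthogonal to every `θ n`, says
that its norm is zero. -/
theorem exists_hilbertBasis {θ : ℤ → ℝ → ℂ} (hθ : ∀ n, MemLp (θ n) 2 ρ)
    (ho : ∀ n n' : ℤ, ∫ t, θ n t * conj (θ n' t) ∂ρ = if n = n' then 1 else 0)
    (hc : ∀ g h : ℝ → ℂ, MemLp g 2 ρ → MemLp h 2 ρ →
      HasSum (fun n : ℤ => (∫ t, conj (g t) * θ n t ∂ρ) * ∫ t, conj (θ n t) * h t ∂ρ)
        (∫ t, conj (g t) * h t ∂ρ)) :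
    ∃ b : HilbertBasis ℤ ℂ (Lp ℂ 2 ρ), ∀ n, b n = (hθ n).toLp (θ n) := by
  have hon : Orthonormal ℂ fun n => (hθ n).toLp (θ n) := by
    rw [orthonormal_iff_ite]
    intro i j
    rw [inner_toLp]
    simp_rw [mul_comm (conj _), ho j i, eq_comm]
  refine ⟨HilbertBasis.mkOfOrthogonalEqBot hon ?_, fun n => ?_⟩
  · rw [Submodule.eq_bot_iff]
    intro h hh
    have hm := Lp.memLp h
    have h0 : ∀ n, ∫ t, conj (θ n t) * h t ∂ρ = 0 := by
      intro n
      rw [← inner_toLp ρ (hθ n) hm, Lp.toLp_coeFn]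
      exact hh _ (Submodule.subset_span ⟨n, rfl⟩)
    have h1 := hc h h hm hm
    simp_rw [h0, mul_zero] at h1
    rw [← inner_toLp ρ hm hm, Lp.toLp_coeFn] at h1
    exact inner_self_eq_zero.1 (h1.unique hasSum_zero)
  · rw [HilbertBasis.coe_mkOfOrthogonalEqBot]

end Spectral

/-- This passes from unconditional sums to the symmetric limits of the analysis formula. -/
theorem tendsto_finset_Ico_neg :
    Tendsto (fun M : ℕ => Finset.Ico (-(M : ℤ)) (M : ℤ)) atTop atTop := by
  refine tendsto_atTop_finset_of_monotone (fun a b h => ?_) fun n => ⟨n.natAbs + 1, ?_⟩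
  · exact Finset.Ico_subset_Ico (by simpa using h) (by exact_mod_cast h)
  · have h1 := neg_abs_le n
    have h2 := le_abs_self n
    rw [Finset.mem_Ico]
    push_cast
    omega

theorem setIntegral_restrict_Ico {A : Set ℝ} (hA : MeasurableSet A) (hA1 : A ⊆ Ico 0 1)
    (f : ℝ → ℂ) : ∫ t in A, f t ∂(volume.restrict (Ico (0 : ℝ) 1)) = ∫ t in A, f t := by
  rw [Measure.restrict_restrict hA, inter_eq_left.2 hA1]

/-- Uniformly bounded functions `θ n` that form a Hilbert basis of `L²[0,1)`, and a Bessel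
sequence `x`, give a spectral process. -/
theorem exists_isSpectralProcess {H : Type*} [NormedAddCommGroup H] [InnerProductSpace ℂ H]
    [CompleteSpace H] {x : ℤ → H} {C : ℝ}
    (hC : ∀ (n : ℤ) (F : Finset ℤ), ∑ m ∈ F, ‖inner ℂ (x n) (x m)‖ ≤ C)
    {θ : ℤ → ℝ → ℂ} (hm : ∀ n, Measurable (θ n)) {D : ℝ} (hD : ∀ n t, ‖θ n t‖ ≤ D)
    (hθ : ∀ n, MemLp (θ n) 2 (volume.restrict (Ico (0 : ℝ) 1)))
    (b : HilbertBasis ℤ ℂ (Lp ℂ 2 (volume.restrict (Ico (0 : ℝ) 1))))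
    (hb : ∀ n, b n = (hθ n).toLp (θ n)) :
    ∃ Φ : Lp ℂ 2 (volume.restrict (Ico (0 : ℝ) 1)) →L[ℂ] H,
      (∀ g, HasSum (fun n => inner ℂ (b n) g • x n) (Φ g)) ∧
      IsSpectralProcess x θ (ofL2 _ Φ) := by
  obtain ⟨Φ, hΦ⟩ := exists_synthesis hC b
  have hC0 : 0 ≤ C := by simpa using hC 0 ∅
  have hD0 : 0 ≤ D := (norm_nonneg _).trans (hD 0 0)
  refine ⟨Φ, hΦ, ⟨fun A hA => ?_, fun n => ?_, fun A hA hA1 => ?_, fun t ht => ?_⟩⟩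
  · rw [ofL2_apply _ Φ hA, ofL2_apply _ Φ (hA.inter measurableSet_Ico)]
    congr 1
    unfold indL2
    rw [indicatorConstLp_inj hA _ (hA.inter measurableSet_Ico) _ one_ne_zero]
    refine (ae_restrict_mem measurableSet_Ico).mono fun t ht => propext ?_
    exact ⟨fun h => ⟨h, ht⟩, fun h => h.1⟩
  · have hmem : MemLp ((Ico (0 : ℝ) 1).indicator (θ n)) 2 (volume.restrict (Ico (0 : ℝ) 1)) :=
      memLp_indicator_of_bound _ (hm n) measurableSet_Ico fun t _ => hD n t
    have h1 := hasIntegral_ofL2 _ Φ measurableSet_Ico (hm n) (fun t _ => hD n t) hmem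
    have h2 : hmem.toLp _ = b n := by
      rw [hb, MemLp.toLp_eq_toLp_iff]
      exact (ae_restrict_mem measurableSet_Ico).mono fun t ht => indicator_of_mem ht _
    have h3 : Φ (b n) = x n := by
      refine (hΦ (b n)).unique ?_
      convert hasSum_ite_eq n (x n) using 2 with m
      rw [orthonormal_iff_ite.1 b.orthonormal]
      split_ifs with h <;> simp [h]
    rwa [h2, h3] at h1
  · rw [ofL2_apply _ Φ hA]
    have h1 := (hΦ (indL2 _ hA)).comp tendsto_finset_Ico_neg
    refine h1.congr fun M => Finset.sum_congr rfl fun n _ => ?_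
    simp only
    rw [hb, inner_toLp_indL2, setIntegral_restrict_Ico hA hA1]
  · have h0 : ofL2 (volume.restrict (Ico (0 : ℝ) 1)) Φ {t} = 0 := by
      rw [ofL2_apply _ Φ (measurableSet_singleton t)]
      have : indL2 (volume.restrict (Ico (0 : ℝ) 1)) (measurableSet_singleton t) = 0 := by
        rw [indL2, ← indicatorConstLp_empty (p := 2) (c := (1 : ℂ)),
          indicatorConstLp_inj _ _ _ _ one_ne_zero, ae_eq_empty]
        simp
      rw [this, map_zero]
    rw [h0]
    -- The mass at `t` is zero, and by Schur's test the squared norm of the average is at most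
    -- `(2M)⁻² · C · 2M D² = C D² / (2M)`.
    have hlim : Tendsto (fun M : ℕ => Real.sqrt (C * D ^ 2 / 2 / (M : ℝ))) atTop (𝓝 0) := by
      have := (tendsto_const_div_atTop_nhds_zero_nat (C * D ^ 2 / 2)).sqrt
      simpa using this
    refine squeeze_zero_norm' ?_ hlim
    filter_upwards [eventually_gt_atTop 0] with M hM
    refine Real.le_sqrt_of_sq_le ?_
    have hM' : (0 : ℝ) < M := by exact_mod_cast hM
    rw [norm_smul, mul_pow]
    have h1 := norm_sum_smul_sq_le hC (fun n => conj (θ n t)) (Finset.Ico (-(M : ℤ)) (M : ℤ))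
    have h2 : ∑ n ∈ Finset.Ico (-(M : ℤ)) (M : ℤ), ‖conj (θ n t)‖ ^ 2 ≤ 2 * M * D ^ 2 := by
      refine (Finset.sum_le_card_nsmul _ _ (D ^ 2) fun n _ => ?_).trans_eq ?_
      · rw [RCLike.norm_conj]
        exact pow_le_pow_left₀ (norm_nonneg _) (hD n t) 2
      · have : ((M : ℤ) - -(M : ℤ)).toNat = 2 * M := by omega
        rw [Int.card_Ico, this, nsmul_eq_mul]
        push_cast
        ring
    have h3 : ‖(1 / (2 * (M : ℂ)))‖ = 1 / (2 * (M : ℝ)) := by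
      rw [norm_div, norm_mul]; simp
    rw [h3]
    calc (1 / (2 * (M : ℝ))) ^ 2 * _ ≤ (1 / (2 * (M : ℝ))) ^ 2 * (C * (2 * M * D ^ 2)) := by
          refine mul_le_mul_of_nonneg_left (h1.trans ?_) (by positivity)
          exact mul_le_mul_of_nonneg_left h2 hC0
      _ = _ := by field_simp

/-- The analysis formula expresses the measure of a subset of `[0, 1)` through `x` and `θ` alone. -/
theorem IsSpectralProcess.unique {H : Type*} [NormedAddCommGroup H] [NormedSpace ℂ H]
    {x : ℤ → H} {θ : ℤ → ℝ → ℂ} {η η' : VectorMeasure ℝ H} (h : IsSpectralProcess x θ η)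
    (h' : IsSpectralProcess x θ η') : η = η' := by
  rw [VectorMeasure.ext_iff]
  intro A hA
  rw [h.support A hA, h'.support A hA]
  exact tendsto_nhds_unique
    (h.analysis _ (hA.inter measurableSet_Ico) inter_subset_right)
    (h'.analysis _ (hA.inter measurableSet_Ico) inter_subset_right)

end CycloKL

namespace CycloKL

/-! ### The Fourier basis on `[0, 1)` -/

section Fourier

theorem measurable_expo (n : ℤ) : Measurable (expo n) := by
  unfold expo
  fun_prop

theorem norm_expo (n : ℤ) (f : ℝ) : ‖expo n f‖ = 1 := by
  have : 2 * (Real.pi : ℂ) * Complex.I * (f : ℂ) * (n : ℂ) =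
      ((2 * Real.pi * f * n : ℝ) : ℂ) * Complex.I := by push_cast; ring
  rw [expo, this, Complex.norm_exp_ofReal_mul_I]

theorem fourier_coe_eq_expo (n : ℤ) (t : ℝ) :
    fourier n ((t : ℝ) : AddCircle (1 : ℝ)) = expo n t := by
  rw [fourier_coe_apply, expo]
  congr 1
  push_cast
  ring

theorem integral_haarAddCircle_one (f : AddCircle (1 : ℝ) → ℂ) :
    ∫ z, f z ∂AddCircle.haarAddCircle = ∫ t in Ico (0 : ℝ) 1, f t := by
  rw [AddCircle.integral_haarAddCircle, inv_one, one_smul, ← AddCircle.integral_preimage 1 0,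
    zero_add, setIntegral_congr_set Ico_ae_eq_Ioc]

theorem expo_orthonormal (n n' : ℤ) :
    ∫ t in Ico (0 : ℝ) 1, expo n t * conj (expo n' t) = if n = n' then 1 else 0 := by
  have h := orthonormal_iff_ite.1 (orthonormal_fourier (T := (1 : ℝ))) n' n
  rw [L2.inner_def] at h
  have h2 : ∫ z, fourier n z * conj (fourier n' z) ∂(AddCircle.haarAddCircle (T := (1 : ℝ))) =
      if n' = n then 1 else 0 := by
    rw [← h]
    refine integral_congr_ae ?_
    filter_upwards [coeFn_fourierLp (T := (1 : ℝ)) 2 n, coeFn_fourierLp (T := (1 : ℝ)) 2 n']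
      with z h1 h2
    rw [h1, h2, RCLike.inner_apply]
  rw [integral_haarAddCircle_one] at h2
  simp_rw [fourier_coe_eq_expo] at h2
  rw [h2]
  simp_rw [eq_comm]

/-- Parseval's identity for `fourierBasis` on the circle, applied to lifts. The lifts use `(0, 1]`,
which differs from `[0, 1)` by a null set. -/
theorem expo_complete (g h : ℝ → ℂ) (hg : MemLp g 2 (volume.restrict (Ico (0 : ℝ) 1)))
    (hh : MemLp h 2 (volume.restrict (Ico (0 : ℝ) 1))) :
    HasSum (fun n : ℤ => (∫ t in Ico (0 : ℝ) 1, conj (g t) * expo n t) *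
      ∫ t in Ico (0 : ℝ) 1, conj (expo n t) * h t) (∫ t in Ico (0 : ℝ) 1, conj (g t) * h t) := by
  have lift : ∀ {f : ℝ → ℂ}, MemLp f 2 (volume.restrict (Ico (0 : ℝ) 1)) →
      MemLp (AddCircle.liftIoc (1 : ℝ) 0 f) 2 AddCircle.haarAddCircle := by
    intro f hf
    rw [memLp_haarAddCircle_iff]
    refine MemLp.memLp_liftIoc ?_
    rwa [zero_add, ← Measure.restrict_congr_set Ico_ae_eq_Ioc]
  have coe : ∀ (f : ℝ → ℂ), ∀ᵐ t ∂(volume.restrict (Ico (0 : ℝ) 1)),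
      AddCircle.liftIoc (1 : ℝ) 0 f ((t : ℝ) : AddCircle (1 : ℝ)) = f t := by
    intro f
    rw [Measure.restrict_congr_set Ico_ae_eq_Ioc]
    refine (ae_restrict_mem measurableSet_Ioc).mono fun t ht => ?_
    exact AddCircle.liftIoc_zero_coe_apply ht
  have hF : ∀ n : ℤ, MemLp (fourier n : AddCircle (1 : ℝ) → ℂ) 2 AddCircle.haarAddCircle :=
    fun n => MemLp.of_bound (fourier n).continuous.aestronglyMeasurable 1
      (ae_of_all _ fun z => by rw [fourier_apply, Circle.norm_coe])
  have hFL : ∀ n : ℤ, fourierBasis n = (hF n).toLp _ := by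
    intro n
    rw [coe_fourierBasis]
    refine Lp.ext ?_
    exact (coeFn_fourierLp 2 n).trans (hF n).coeFn_toLp.symm
  have key := fourierBasis.hasSum_inner_mul_inner ((lift hg).toLp _) ((lift hh).toLp _)
  simp_rw [hFL, inner_toLp, integral_haarAddCircle_one, fourier_coe_eq_expo] at key
  have h1 : ∀ n : ℤ, ∫ t in Ico (0 : ℝ) 1, conj (AddCircle.liftIoc (1 : ℝ) 0 g t) * expo n t =
      ∫ t in Ico (0 : ℝ) 1, conj (g t) * expo n t := fun n => integral_congr_ae <| by
    filter_upwards [coe g] with t ht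
    rw [ht]
  have h2 : ∀ n : ℤ, ∫ t in Ico (0 : ℝ) 1, conj (expo n t) * AddCircle.liftIoc (1 : ℝ) 0 h t =
      ∫ t in Ico (0 : ℝ) 1, conj (expo n t) * h t := fun n => integral_congr_ae <| by
    filter_upwards [coe h] with t ht
    rw [ht]
  have h3 : ∫ t in Ico (0 : ℝ) 1, conj (AddCircle.liftIoc (1 : ℝ) 0 g t) *
      AddCircle.liftIoc (1 : ℝ) 0 h t = ∫ t in Ico (0 : ℝ) 1, conj (g t) * h t :=
    integral_congr_ae <| by
      filter_upwards [coe g, coe h] with t h1 h2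
      rw [h1, h2]
  simpa only [h1, h2, h3] using key

end Fourier

/-! ### Splitting `[0, 1)` into `P` bands -/

section Bands

variable {P : ℕ}

/-- After multiplication by `P`, membership forces the integers `p` and `q` to differ by less than
1. -/
theorem mem_band_iff (hP : 0 < P) {σ : ℝ} (hσ : σ ∈ Ico (0 : ℝ) (1 / P)) (p q : Fin P) :
    σ + ((p : ℕ) : ℝ) / P ∈ Ico (((q : ℕ) : ℝ) / P) ((((q : ℕ) : ℝ) + 1) / P) ↔ q = p := by
  have hP' : (0 : ℝ) < P := by exact_mod_cast hP
  constructor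
  · rintro ⟨h1, h2⟩
    have h3 : σ * P < 1 := by rw [← lt_div_iff₀ hP']; exact hσ.2
    have h4 : 0 ≤ σ * P := mul_nonneg hσ.1 hP'.le
    rw [div_le_iff₀ hP', add_mul, div_mul_cancel₀ _ hP'.ne'] at h1
    rw [lt_div_iff₀ hP', add_mul, div_mul_cancel₀ _ hP'.ne'] at h2
    have h5 : ((q : ℕ) : ℝ) < (p : ℕ) + 1 := by linarith
    have h6 : ((p : ℕ) : ℝ) < (q : ℕ) + 1 := by linarith
    have h7 : (q : ℕ) < p + 1 := by exact_mod_cast h5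
    have h8 : (p : ℕ) < q + 1 := by exact_mod_cast h6
    exact Fin.ext (by omega)
  · rintro rfl
    refine ⟨by linarith [hσ.1], ?_⟩
    rw [add_div]
    linarith [hσ.2]

theorem joinBands_add_div {E : Type*} [AddCommMonoid E] (hP : 0 < P) (g : Fin P → ℝ → E)
    {σ : ℝ} (hσ : σ ∈ Ico (0 : ℝ) (1 / P)) (p : Fin P) :
    joinBands P g (σ + ((p : ℕ) : ℝ) / P) = g p σ := by
  unfold joinBands
  rw [Finset.sum_eq_single p]
  · rw [indicator_of_mem ((mem_band_iff hP hσ p p).2 rfl), add_sub_cancel_right]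
  · intro q _ hq
    exact indicator_of_notMem (fun h => hq ((mem_band_iff hP hσ p q).1 h)) _
  · simp

theorem add_div_mem_Ico (hP : 0 < P) {σ : ℝ} (hσ : σ ∈ Ico (0 : ℝ) (1 / P)) (p : Fin P) :
    σ + ((p : ℕ) : ℝ) / P ∈ Ico (0 : ℝ) 1 := by
  have hP' : (0 : ℝ) < P := by exact_mod_cast hP
  have h : ((p : ℕ) : ℝ) + 1 ≤ P := by exact_mod_cast p.2
  have h2 : ((p : ℕ) : ℝ) / P + 1 / P ≤ 1 := by rwa [← add_div, div_le_one hP']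
  exact ⟨add_nonneg hσ.1 (by positivity), by linarith [hσ.2]⟩

theorem exists_band (hP : 0 < P) {t : ℝ} (ht : t ∈ Ico (0 : ℝ) 1) :
    ∃ (p : Fin P) (σ : ℝ), σ ∈ Ico (0 : ℝ) (1 / P) ∧ t = σ + ((p : ℕ) : ℝ) / P := by
  have hP' : (0 : ℝ) < P := by exact_mod_cast hP
  have h0 : 0 ≤ t * P := mul_nonneg ht.1 hP'.le
  have h1 : ⌊t * P⌋₊ < P := by
    rw [Nat.floor_lt h0]
    nlinarith [ht.2]
  refine ⟨⟨⌊t * P⌋₊, h1⟩, t - (⌊t * P⌋₊ : ℝ) / P, ⟨?_, ?_⟩, by simp⟩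
  · rw [sub_nonneg, div_le_iff₀ hP']
    exact Nat.floor_le h0
  · rw [sub_lt_iff_lt_add, ← add_div, lt_div_iff₀ hP']
    linarith [Nat.lt_floor_add_one (t * P)]

theorem iUnion_band (hP : 0 < P) :
    (⋃ p : Fin P, Ico (((p : ℕ) : ℝ) / P) ((((p : ℕ) : ℝ) + 1) / P)) = Ico (0 : ℝ) 1 := by
  have hP' : (0 : ℝ) < P := by exact_mod_cast hP
  ext t
  rw [mem_iUnion]
  constructor
  · rintro ⟨p, h1, h2⟩
    have h3 := add_div_mem_Ico hP (σ := t - ((p : ℕ) : ℝ) / P)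
      ⟨by linarith, by rw [add_div] at h2; linarith⟩ p
    simpa using h3
  · intro ht
    obtain ⟨p, σ, hσ, rfl⟩ := exists_band hP ht
    exact ⟨p, (mem_band_iff hP hσ p p).2 rfl⟩

theorem joinBands_of_notMem {E : Type*} [AddCommMonoid E] (hP : 0 < P) (g : Fin P → ℝ → E)
    {t : ℝ} (ht : t ∉ Ico (0 : ℝ) 1) : joinBands P g t = 0 := by
  refine Finset.sum_eq_zero fun p _ => indicator_of_notMem (fun h => ht ?_) _
  rw [← iUnion_band hP]
  exact mem_iUnion.2 ⟨p, h⟩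

theorem measurable_joinBands {E : Type*} [AddCommMonoid E] [MeasurableSpace E] [MeasurableAdd₂ E]
    {g : Fin P → ℝ → E} (hg : ∀ p, Measurable (g p)) : Measurable (joinBands P g) := by
  unfold joinBands
  refine Finset.measurable_sum _ fun p _ => Measurable.indicator ?_ measurableSet_Ico
  exact (hg p).comp (measurable_id.sub_const _)

theorem norm_joinBands_le {E : Type*} [NormedAddCommGroup E] (hP : 0 < P) {g : Fin P → ℝ → E}
    {C : ℝ} (hC : ∀ σ ∈ Ico (0 : ℝ) (1 / P), ∀ p, ‖g p σ‖ ≤ C) (t : ℝ) :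
    ‖joinBands P g t‖ ≤ C := by
  have hP' : (0 : ℝ) < P := by exact_mod_cast hP
  by_cases ht : t ∈ Ico (0 : ℝ) 1
  · obtain ⟨p, σ, hσ, rfl⟩ := exists_band hP ht
    rw [joinBands_add_div hP g hσ]
    exact hC σ hσ p
  · rw [joinBands_of_notMem hP g ht, norm_zero]
    exact (norm_nonneg _).trans (hC 0 ⟨le_rfl, by positivity⟩ ⟨0, hP⟩)

theorem preimage_add_div_band (p : Fin P) :
    (fun σ : ℝ => σ + ((p : ℕ) : ℝ) / P) ⁻¹' Ico (((p : ℕ) : ℝ) / P) ((((p : ℕ) : ℝ) + 1) / P) =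
      Ico (0 : ℝ) (1 / P) := by
  rw [preimage_add_const_Ico, sub_self, add_div, add_sub_cancel_left]

theorem integrableOn_band (hP : 0 < P) {f : ℝ → ℂ} (hf : IntegrableOn f (Ico (0 : ℝ) 1))
    (p : Fin P) :
    IntegrableOn (fun σ => f (σ + ((p : ℕ) : ℝ) / P)) (Ico (0 : ℝ) (1 / P)) := by
  have h := hf.mono_set ((subset_iUnion _ p).trans (iUnion_band hP).subset)
  rw [← preimage_add_div_band p]
  exact ((measurePreserving_add_right volume _).integrableOn_comp_preimage
    (measurableEmbedding_addRight _)).2 h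

theorem setIntegral_eq_sum_bands (hP : 0 < P) {f : ℝ → ℂ} (hf : IntegrableOn f (Ico (0 : ℝ) 1)) :
    ∫ t in Ico (0 : ℝ) 1, f t =
      ∑ p : Fin P, ∫ σ in Ico (0 : ℝ) (1 / P), f (σ + ((p : ℕ) : ℝ) / P) := by
  have hd : Pairwise (Function.onFun Disjoint
      fun p : Fin P => Ico (((p : ℕ) : ℝ) / P) ((((p : ℕ) : ℝ) + 1) / P)) := by
    intro p q hpq
    refine disjoint_left.2 fun t htp htq => hpq ?_
    have h1 : t - ((p : ℕ) : ℝ) / P ∈ Ico (0 : ℝ) (1 / P) := by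
      rw [← preimage_add_div_band p]
      simpa using htp
    have h2 := (mem_band_iff hP h1 p q).1 (by simpa using htq)
    exact h2.symm
  rw [← iUnion_band hP, integral_iUnion_fintype (fun _ => measurableSet_Ico) hd fun p =>
    hf.mono_set ((subset_iUnion _ p).trans (iUnion_band hP).subset)]
  refine Finset.sum_congr rfl fun p _ => ?_
  rw [← preimage_add_div_band p]
  exact ((measurePreserving_add_right volume _).setIntegral_preimage_emb
    (measurableEmbedding_addRight _) _ _).symm

end Bands

end CycloKL

namespace CycloKL

/-! ### Unitary mixing of the bands and the basis `φ` -/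

section Mixing

variable {P : ℕ}

/-- The function whose bands are obtained by applying `conj (B σ)` to the bands of `g`. -/
noncomputable def mixBands (P : ℕ) (B : ℝ → Matrix (Fin P) (Fin P) ℂ) (g : ℝ → ℂ) : ℝ → ℂ :=
  joinBands P fun q σ => ∑ p : Fin P, conj (B σ q p) * g (σ + ((p : ℕ) : ℝ) / P)

variable {B : ℝ → Matrix (Fin P) (Fin P) ℂ}

theorem sum_conj_mul_of_mem_unitary {U : Matrix (Fin P) (Fin P) ℂ}
    (hU : U ∈ Matrix.unitaryGroup (Fin P) ℂ) (p p' : Fin P) :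
    ∑ q, U q p * conj (U q p') = if p = p' then 1 else 0 := by
  have h := congrFun (congrFun (Matrix.mem_unitaryGroup_iff'.1 hU) p') p
  rw [Matrix.mul_apply, Matrix.one_apply] at h
  simp_rw [eq_comm (a := p), ← h]
  refine Finset.sum_congr rfl fun q _ => ?_
  rw [mul_comm]
  rfl

theorem sum_mul_conj_of_mem_unitary {U : Matrix (Fin P) (Fin P) ℂ}
    (hU : U ∈ Matrix.unitaryGroup (Fin P) ℂ) (q q' : Fin P) :
    ∑ p, U q p * conj (U q' p) = if q = q' then 1 else 0 := by
  have h := congrFun (congrFun (Matrix.mem_unitaryGroup_iff.1 hU) q) q'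
  rw [Matrix.mul_apply, Matrix.one_apply] at h
  rw [← h]
  rfl

/-- The entrywise conjugate of a unitary matrix is unitary; the triple sum collapses by
orthogonality of the columns. -/
theorem sum_conj_mulVec_mul {U : Matrix (Fin P) (Fin P) ℂ}
    (hU : U ∈ Matrix.unitaryGroup (Fin P) ℂ) (u v : Fin P → ℂ) :
    ∑ q, conj (∑ p, conj (U q p) * u p) * (∑ p, conj (U q p) * v p) = ∑ p, conj (u p) * v p := by
  simp_rw [map_sum, map_mul, Complex.conj_conj, Finset.sum_mul_sum]
  rw [Finset.sum_comm]
  refine Finset.sum_congr rfl fun p _ => ?_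
  rw [Finset.sum_comm]
  have h : ∀ p', ∑ q, U q p * conj (u p) * (conj (U q p') * v p') =
      if p = p' then conj (u p) * v p' else 0 := by
    intro p'
    rw [← boole_mul, ← sum_conj_mul_of_mem_unitary hU p p', Finset.sum_mul]
    exact Finset.sum_congr rfl fun q _ => by ring
  simp_rw [h]
  simp

theorem norm_entry_le_one (hBunit : ∀ σ ∈ Ico (0 : ℝ) (1 / P), B σ ∈ Matrix.unitaryGroup (Fin P) ℂ)
    {σ : ℝ} (hσ : σ ∈ Ico (0 : ℝ) (1 / P)) (q p : Fin P) : ‖B σ q p‖ ≤ 1 :=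
  entry_norm_bound_of_unitary (hBunit σ hσ) q p

/-- With `g` extended by zero to the line, the mixed function is a finite sum of translates of `g`,
each multiplied by a measurable coefficient of modulus at most 1. -/
theorem memLp_mixBands (hP : 0 < P) (hBmeas : ∀ q p : Fin P, Measurable fun σ => B σ q p)
    (hBunit : ∀ σ ∈ Ico (0 : ℝ) (1 / P), B σ ∈ Matrix.unitaryGroup (Fin P) ℂ) {g : ℝ → ℂ}
    (hg : MemLp g 2 (volume.restrict (Ico (0 : ℝ) 1))) :
    MemLp (mixBands P B g) 2 (volume.restrict (Ico (0 : ℝ) 1)) := by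
  have hG : MemLp ((Ico (0 : ℝ) 1).indicator g) 2 volume :=
    (memLp_indicator_iff_restrict measurableSet_Ico).2 hg
  let I : Fin P → Set ℝ := fun q => Ico (((q : ℕ) : ℝ) / P) ((((q : ℕ) : ℝ) + 1) / P)
  let F : Fin P → Fin P → ℝ → ℂ := fun q p t =>
    (I q).indicator (fun t => conj (B (t - ((q : ℕ) : ℝ) / P) q p)) t *
      (Ico (0 : ℝ) 1).indicator g (t + (((p : ℕ) : ℝ) / P - ((q : ℕ) : ℝ) / P))
  have hI : ∀ q t, t ∈ I q → t - ((q : ℕ) : ℝ) / P ∈ Ico (0 : ℝ) (1 / P) := by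
    intro q t ht
    rw [← preimage_add_div_band q, mem_preimage, sub_add_cancel]
    exact ht
  have hF : ∀ q p, MemLp (F q p) 2 volume := by
    intro q p
    have h1 := hG.comp_measurePreserving
      (measurePreserving_add_right volume (((p : ℕ) : ℝ) / P - ((q : ℕ) : ℝ) / P))
    refine MemLp.of_le_mul (c := 1) h1 (AEStronglyMeasurable.mul ?_ h1.1)
      (ae_of_all _ fun t => ?_)
    · refine Measurable.aestronglyMeasurable (Measurable.indicator ?_ measurableSet_Ico)
      exact Complex.continuous_conj.measurable.comp
        ((hBmeas q p).comp (measurable_id.sub_const _))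
    · simp only [F]
      rw [norm_mul]
      refine mul_le_mul_of_nonneg_right ?_ (norm_nonneg _)
      by_cases ht : t ∈ I q
      · rw [indicator_of_mem ht, RCLike.norm_conj]
        exact norm_entry_le_one hBunit (hI q t ht) q p
      · rw [indicator_of_notMem ht]
        simp
  have hsum : mixBands P B g = ∑ q, ∑ p, F q p := by
    ext t
    simp only [mixBands, joinBands, Finset.sum_apply]
    refine Finset.sum_congr rfl fun q _ => ?_
    by_cases ht : t ∈ I q
    · rw [indicator_of_mem ht]
      refine Finset.sum_congr rfl fun p _ => ?_
      simp only [F]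
      rw [indicator_of_mem ht]
      have h1 : t + (((p : ℕ) : ℝ) / P - ((q : ℕ) : ℝ) / P) =
        t - ((q : ℕ) : ℝ) / P + ((p : ℕ) : ℝ) / P := by ring
      rw [h1, indicator_of_mem (add_div_mem_Ico hP (hI q t ht) p)]
    · rw [indicator_of_notMem ht]
      refine (Finset.sum_eq_zero fun p _ => ?_).symm
      simp only [F]
      rw [indicator_of_notMem ht, zero_mul]
  rw [hsum]
  exact (memLp_finsetSum' _ fun q _ => memLp_finsetSum' _ fun p _ => hF q p).restrict _

theorem integrableOn_conj_mul {g h : ℝ → ℂ} {s : Set ℝ} (hg : MemLp g 2 (volume.restrict s))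
    (hh : MemLp h 2 (volume.restrict s)) : IntegrableOn (fun t => conj (g t) * h t) s :=
  hg.star.integrable_mul hh

theorem integral_conj_mixBands_mul (hP : 0 < P)
    (hBmeas : ∀ q p : Fin P, Measurable fun σ => B σ q p)
    (hBunit : ∀ σ ∈ Ico (0 : ℝ) (1 / P), B σ ∈ Matrix.unitaryGroup (Fin P) ℂ) {g h : ℝ → ℂ}
    (hg : MemLp g 2 (volume.restrict (Ico (0 : ℝ) 1)))
    (hh : MemLp h 2 (volume.restrict (Ico (0 : ℝ) 1))) :
    ∫ t in Ico (0 : ℝ) 1, conj (mixBands P B g t) * mixBands P B h t =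
      ∫ t in Ico (0 : ℝ) 1, conj (g t) * h t := by
  have h1 := integrableOn_conj_mul hg hh
  have h2 := integrableOn_conj_mul (memLp_mixBands hP hBmeas hBunit hg)
    (memLp_mixBands hP hBmeas hBunit hh)
  rw [setIntegral_eq_sum_bands hP h1, setIntegral_eq_sum_bands hP h2,
    ← integral_finsetSum _ fun p _ => integrableOn_band hP h1 p,
    ← integral_finsetSum _ fun p _ => integrableOn_band hP h2 p]
  refine setIntegral_congr_fun measurableSet_Ico fun σ hσ => ?_
  simp only [mixBands, joinBands_add_div hP _ hσ]
  exact sum_conj_mulVec_mul (hBunit σ hσ) _ _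

theorem measurable_csBasis (hBmeas : ∀ q p : Fin P, Measurable fun σ => B σ q p) (n : ℤ) :
    Measurable (csBasis P B n) := by
  refine measurable_joinBands fun p => Finset.measurable_sum _ fun q _ => ?_
  exact (hBmeas q p).mul ((measurable_expo n).comp (measurable_id.add_const _))

theorem norm_csBasis_le (hP : 0 < P)
    (hBunit : ∀ σ ∈ Ico (0 : ℝ) (1 / P), B σ ∈ Matrix.unitaryGroup (Fin P) ℂ) (n : ℤ) (t : ℝ) :
    ‖csBasis P B n t‖ ≤ P := by
  refine norm_joinBands_le hP (fun σ hσ p => ?_) t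
  refine (norm_sum_le _ _).trans ((Finset.sum_le_card_nsmul _ _ 1 fun q _ => ?_).trans_eq ?_)
  · rw [norm_mul, norm_expo, mul_one]
    exact norm_entry_le_one hBunit hσ q p
  · simp

theorem memLp_csBasis (hP : 0 < P) (hBmeas : ∀ q p : Fin P, Measurable fun σ => B σ q p)
    (hBunit : ∀ σ ∈ Ico (0 : ℝ) (1 / P), B σ ∈ Matrix.unitaryGroup (Fin P) ℂ) (n : ℤ) :
    MemLp (csBasis P B n) 2 (volume.restrict (Ico (0 : ℝ) 1)) :=
  MemLp.of_bound (measurable_csBasis hBmeas n).aestronglyMeasurable P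
    (ae_of_all _ (norm_csBasis_le hP hBunit n))

/-- Orthogonality of the rows of `B σ` undoes the combination that defines `φ`. Orthonormality and
completeness of `φ` follow, because mixing preserves inner products. -/
theorem mixBands_csBasis (hP : 0 < P)
    (hBunit : ∀ σ ∈ Ico (0 : ℝ) (1 / P), B σ ∈ Matrix.unitaryGroup (Fin P) ℂ) (n : ℤ) {t : ℝ}
    (ht : t ∈ Ico (0 : ℝ) 1) : mixBands P B (csBasis P B n) t = expo n t := by
  obtain ⟨q, σ, hσ, rfl⟩ := exists_band hP ht
  simp only [mixBands, csBasis, joinBands_add_div hP _ hσ]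
  simp_rw [Finset.mul_sum]
  rw [Finset.sum_comm]
  have h : ∀ q', ∑ p, conj (B σ q p) * (B σ q' p * expo n (σ + ((q' : ℕ) : ℝ) / P)) =
      if q' = q then expo n (σ + ((q' : ℕ) : ℝ) / P) else 0 := by
    intro q'
    have h2 := sum_mul_conj_of_mem_unitary (hBunit σ hσ) q' q
    rw [← boole_mul, ← h2, Finset.sum_mul]
    exact Finset.sum_congr rfl fun p _ => by ring
  simp_rw [h]
  simp

theorem csBasis_orthonormal (hP : 0 < P) (hBmeas : ∀ q p : Fin P, Measurable fun σ => B σ q p)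
    (hBunit : ∀ σ ∈ Ico (0 : ℝ) (1 / P), B σ ∈ Matrix.unitaryGroup (Fin P) ℂ) (n n' : ℤ) :
    ∫ t in Ico (0 : ℝ) 1, csBasis P B n t * conj (csBasis P B n' t) =
      if n = n' then 1 else 0 := by
  rw [← expo_orthonormal]
  simp_rw [mul_comm _ (conj _)]
  rw [← integral_conj_mixBands_mul hP hBmeas hBunit (memLp_csBasis hP hBmeas hBunit n')
    (memLp_csBasis hP hBmeas hBunit n)]
  refine setIntegral_congr_fun measurableSet_Ico fun t ht => ?_
  simp only [mixBands_csBasis hP hBunit _ ht]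

theorem csBasis_complete (hP : 0 < P) (hBmeas : ∀ q p : Fin P, Measurable fun σ => B σ q p)
    (hBunit : ∀ σ ∈ Ico (0 : ℝ) (1 / P), B σ ∈ Matrix.unitaryGroup (Fin P) ℂ) (g h : ℝ → ℂ)
    (hg : MemLp g 2 (volume.restrict (Ico (0 : ℝ) 1)))
    (hh : MemLp h 2 (volume.restrict (Ico (0 : ℝ) 1))) :
    HasSum (fun n : ℤ => (∫ t in Ico (0 : ℝ) 1, conj (g t) * csBasis P B n t) *
      ∫ t in Ico (0 : ℝ) 1, conj (csBasis P B n t) * h t)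
      (∫ t in Ico (0 : ℝ) 1, conj (g t) * h t) := by
  have key := expo_complete _ _ (memLp_mixBands hP hBmeas hBunit hg)
    (memLp_mixBands hP hBmeas hBunit hh)
  rw [integral_conj_mixBands_mul hP hBmeas hBunit hg hh] at key
  convert key using 3 with n
  · rw [← integral_conj_mixBands_mul hP hBmeas hBunit hg (memLp_csBasis hP hBmeas hBunit n)]
    refine setIntegral_congr_fun measurableSet_Ico fun t ht => ?_
    simp only [mixBands_csBasis hP hBunit _ ht]
  · rw [← integral_conj_mixBands_mul hP hBmeas hBunit (memLp_csBasis hP hBmeas hBunit n) hh]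
    refine setIntegral_congr_fun measurableSet_Ico fun t ht => ?_
    simp only [mixBands_csBasis hP hBunit _ ht]

end Mixing

end CycloKL

/-! ### The autocorrelation kernel acting on exponentials -/

namespace CycloKL

theorem sum_exp_eq_ite_dvd {P : ℕ} (hP : 0 < P) (j : ℤ) :
    ∑ r : Fin P, Complex.exp (2 * (Real.pi : ℂ) * Complex.I * (((r : ℕ) : ℂ) * (j : ℂ) / (P : ℂ))) =
      if (P : ℤ) ∣ j then (P : ℂ) else 0 := by
  have hP' : (P : ℂ) ≠ 0 := by exact_mod_cast hP.ne'
  set z := Complex.exp (2 * (Real.pi : ℂ) * Complex.I * ((j : ℂ) / (P : ℂ))) with hz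
  have h1 : ∀ r : ℕ, Complex.exp (2 * (Real.pi : ℂ) * Complex.I * ((r : ℂ) * (j : ℂ) / (P : ℂ))) =
      z ^ r := by
    intro r
    rw [hz, ← Complex.exp_nat_mul]
    congr 1
    ring
  simp_rw [h1]
  rw [Fin.sum_univ_eq_sum_range (fun r => z ^ r)]
  split_ifs with h
  · obtain ⟨d, rfl⟩ := h
    have : z = 1 := by
      rw [hz, Complex.exp_eq_one_iff]
      refine ⟨d, ?_⟩
      push_cast
      field_simp
    simp [this]
  · have hz1 : z ≠ 1 := by
      rw [hz, Ne, Complex.exp_eq_one_iff]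
      rintro ⟨d, hd⟩
      refine h ⟨d, ?_⟩
      have h2 := Complex.two_pi_I_ne_zero
      have h3 : (j : ℂ) / P = d := mul_left_cancel₀ h2 (by rw [hd]; ring)
      rw [div_eq_iff hP'] at h3
      have : (j : ℂ) = ((P * d : ℤ) : ℂ) := by rw [h3]; push_cast; ring
      exact_mod_cast this
    have hzP : z ^ P = 1 := by
      rw [← h1, Complex.exp_eq_one_iff]
      refine ⟨j, ?_⟩
      field_simp
    have h3 := mul_geom_sum z P
    rw [hzP, sub_self] at h3
    exact (mul_eq_zero.1 h3).resolve_left (sub_ne_zero.2 hz1)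

section Cyclostationary

variable {Ω : Type*} [MeasurableSpace Ω] {μ : Measure Ω} {x : ℤ → Ω → ℂ} {P : ℕ}

theorem inner_toL2 (hx : ∀ n, MemLp (x n) 2 μ) (n m : ℤ) :
    inner ℂ (toL2 hx n) (toL2 hx m) = autocorr μ x n (m - n) := by
  rw [toL2, toL2, inner_toLp, autocorr]
  refine integral_congr_ae (ae_of_all _ fun ω => ?_)
  simp only [add_sub_cancel, mul_comm]

theorem summable_norm_inner_toL2 (hx : ∀ n, MemLp (x n) 2 μ)
    (hR : ∀ n : ℤ, Summable fun m : ℤ => autocorr μ x n m) (n : ℤ) :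
    Summable fun m => ‖inner ℂ (toL2 hx n) (toL2 hx m)‖ := by
  simp_rw [inner_toL2]
  exact (Equiv.subRight n).summable_iff.2 (hR n).norm

theorem IsCyclostationary.eq_of_dvd (hx : IsCyclostationary μ x P) {n n' : ℤ}
    (h : (P : ℤ) ∣ n - n') (m : ℤ) : autocorr μ x n m = autocorr μ x n' m := by
  obtain ⟨d, hd⟩ := h
  have h1 : n = n' + d * P := by linarith [mul_comm (P : ℤ) d]
  rw [h1, hx.periodic]

/-- Periodicity reduces `n` to its residue modulo `P`, whose term is one of those on the right. The
bound is uniform in `n`, as Schur's test needs. -/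
theorem tsum_norm_autocorr_le (hP : 0 < P) (hx : IsCyclostationary μ x P) (n : ℤ) :
    ∑' m, ‖autocorr μ x n m‖ ≤ ∑ i ∈ Finset.range P, ∑' m, ‖autocorr μ x (i : ℤ) m‖ := by
  have hP' : (P : ℤ) ≠ 0 := by exact_mod_cast hP.ne'
  have h0 : 0 ≤ n % P := Int.emod_nonneg _ hP'
  have h1 : n % P < P := Int.emod_lt_of_pos _ (by exact_mod_cast hP)
  have h2 : ∀ m, autocorr μ x n m = autocorr μ x ((n % P).toNat : ℤ) m := by
    intro m
    refine hx.eq_of_dvd ?_ m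
    rw [Int.toNat_of_nonneg h0]
    exact Int.dvd_self_sub_emod
  simp_rw [h2]
  exact Finset.single_le_sum (f := fun i : ℕ => ∑' m, ‖autocorr μ x (i : ℤ) m‖)
    (fun i _ => tsum_nonneg fun m => norm_nonneg _) (Finset.mem_range.2 (by omega))

theorem sum_norm_inner_toL2_le (hP : 0 < P) (hx : IsCyclostationary μ x P)
    (hR : ∀ n : ℤ, Summable fun m : ℤ => autocorr μ x n m) (n : ℤ) (F : Finset ℤ) :
    ∑ m ∈ F, ‖inner ℂ (toL2 hx.secondOrder n) (toL2 hx.secondOrder m)‖ ≤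
      ∑ i ∈ Finset.range P, ∑' m, ‖autocorr μ x (i : ℤ) m‖ := by
  refine ((summable_norm_inner_toL2 hx.secondOrder hR n).sum_le_tsum F
    fun m _ => norm_nonneg _).trans (le_trans (le_of_eq ?_) (tsum_norm_autocorr_le hP hx n))
  simp_rw [inner_toL2]
  exact (Equiv.subRight n).tsum_eq fun m => ‖autocorr μ x n m‖

theorem norm_cyclicSpectrum_term (a : ℂ) (k n m : ℤ) (f : ℝ) :
    ‖a * Complex.exp (-(2 * (Real.pi : ℂ) * Complex.I *
        ((k : ℂ) * (n : ℂ) / (P : ℂ) + (f : ℂ) * (m : ℂ))))‖ = ‖a‖ := by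
  have : -(2 * (Real.pi : ℂ) * Complex.I *
      ((k : ℂ) * (n : ℂ) / (P : ℂ) + (f : ℂ) * (m : ℂ))) =
      ((-(2 * Real.pi * ((k : ℝ) * n / P + f * m)) : ℝ) : ℂ) * Complex.I := by
    push_cast; ring
  rw [norm_mul, this, Complex.norm_exp_ofReal_mul_I, mul_one]

theorem summable_cyclicSpectrum_term (hR : ∀ n : ℤ, Summable fun m : ℤ => autocorr μ x n m)
    (k n : ℤ) (f : ℝ) :
    Summable fun m : ℤ => autocorr μ x n m * Complex.exp (-(2 * (Real.pi : ℂ) * Complex.I *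
        ((k : ℂ) * (n : ℂ) / (P : ℂ) + (f : ℂ) * (m : ℂ)))) := by
  refine Summable.of_norm ?_
  simp_rw [norm_cyclicSpectrum_term]
  exact (hR n).norm

theorem continuous_cyclicSpectrum (hR : ∀ n : ℤ, Summable fun m : ℤ => autocorr μ x n m) (k : ℤ) :
    Continuous fun f => cyclicSpectrum μ x P k f := by
  unfold cyclicSpectrum
  refine continuous_const.mul (continuous_finsetSum _ fun n _ => ?_)
  refine continuous_tsum (fun m => by fun_prop) (hR n).norm fun m f => ?_
  exact (norm_cyclicSpectrum_term (P := P) _ k n m f).le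

theorem norm_cyclicSpectrum_le (hP : 0 < P) (hR : ∀ n : ℤ, Summable fun m : ℤ => autocorr μ x n m)
    (k : ℤ) (f : ℝ) : ‖cyclicSpectrum μ x P k f‖ ≤
      ∑ i ∈ Finset.range P, ∑' m, ‖autocorr μ x (i : ℤ) m‖ := by
  have hP' : (1 : ℝ) ≤ P := by exact_mod_cast hP
  have h0 : ‖(1 / (P : ℂ))‖ ≤ 1 := by
    rw [norm_div, norm_one, Complex.norm_natCast]
    exact div_le_one_of_le₀ hP' (by positivity)
  unfold cyclicSpectrum
  rw [norm_mul]
  refine (mul_le_of_le_one_left (norm_nonneg _) h0).trans ((norm_sum_le _ _).trans ?_)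
  refine Finset.sum_le_sum fun n _ => ?_
  refine (norm_tsum_le_tsum_norm (summable_cyclicSpectrum_term hR k n f).norm).trans_eq ?_
  exact tsum_congr fun m => norm_cyclicSpectrum_term (P := P) _ k n m f

/-- The exponentials of the bands are mapped to one another by the cyclic PSD matrix. -/
theorem hasSum_autocorr_mul_expo (hP : 0 < P) (hx : IsCyclostationary μ x P)
    (hR : ∀ n : ℤ, Summable fun m : ℤ => autocorr μ x n m) (σ : ℝ) (q : Fin P) (k : ℤ) :
    HasSum (fun l : ℤ => autocorr μ x l (k - l) * expo l (σ + ((q : ℕ) : ℝ) / P))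
      (∑ r : Fin P, cyclicPSD μ x P σ r q * expo k (σ + ((r : ℕ) : ℝ) / P)) := by
  have hPZ : (P : ℤ) ≠ 0 := by exact_mod_cast hP.ne'
  have hPC : (P : ℂ) ≠ 0 := by exact_mod_cast hP.ne'
  have h1 : HasSum (fun m : ℤ => ∑ r : Fin P, 1 / (P : ℂ) * (∑ n ∈ Finset.range P,
      autocorr μ x (n : ℤ) m * Complex.exp (-(2 * (Real.pi : ℂ) * Complex.I *
        (((((r : ℕ) : ℤ) - ((q : ℕ) : ℤ) : ℤ) : ℂ) * (n : ℂ) / (P : ℂ) +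
          ((σ + ((r : ℕ) : ℝ) / (P : ℝ) : ℝ) : ℂ) * (m : ℂ))))) *
        expo k (σ + ((r : ℕ) : ℝ) / P))
      (∑ r : Fin P, cyclicPSD μ x P σ r q * expo k (σ + ((r : ℕ) : ℝ) / P)) := by
    refine hasSum_sum fun r _ => HasSum.mul_right _ (HasSum.mul_left _ (hasSum_sum fun n _ => ?_))
    exact (summable_cyclicSpectrum_term hR _ n _).hasSum
  rw [← (Equiv.subLeft k).hasSum_iff] at h1
  refine h1.congr_fun ?_
  intro l
  simp only [Function.comp_apply, Equiv.subLeft_apply]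
  -- All dependence on `r` is collected in a root of unity, so the sum over `r` equals `P` if `P ∣ l
  -- - n` and vanishes otherwise.
  have hsplit : ∀ (r : Fin P) (n : ℕ), Complex.exp (-(2 * (Real.pi : ℂ) * Complex.I *
        (((((r : ℕ) : ℤ) - ((q : ℕ) : ℤ) : ℤ) : ℂ) * (n : ℂ) / (P : ℂ) +
          ((σ + ((r : ℕ) : ℝ) / (P : ℝ) : ℝ) : ℂ) * ((k - l : ℤ) : ℂ)))) *
        expo k (σ + ((r : ℕ) : ℝ) / P) =
      Complex.exp (2 * (Real.pi : ℂ) * Complex.I *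
        (((q : ℕ) : ℂ) * (n : ℂ) / (P : ℂ) + (σ : ℂ) * (l : ℂ))) *
      Complex.exp (2 * (Real.pi : ℂ) * Complex.I *
        (((r : ℕ) : ℂ) * ((l - n : ℤ) : ℂ) / (P : ℂ))) := by
    intro r n
    rw [expo, ← Complex.exp_add, ← Complex.exp_add]
    congr 1
    push_cast
    ring
  have hswap : ∑ r : Fin P, 1 / (P : ℂ) * (∑ n ∈ Finset.range P,
      autocorr μ x (n : ℤ) (k - l) * Complex.exp (-(2 * (Real.pi : ℂ) * Complex.I *
        (((((r : ℕ) : ℤ) - ((q : ℕ) : ℤ) : ℤ) : ℂ) * (n : ℂ) / (P : ℂ) +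
          ((σ + ((r : ℕ) : ℝ) / (P : ℝ) : ℝ) : ℂ) * ((k - l : ℤ) : ℂ))))) *
        expo k (σ + ((r : ℕ) : ℝ) / P) =
      ∑ n ∈ Finset.range P, if (P : ℤ) ∣ l - n then autocorr μ x (n : ℤ) (k - l) *
        Complex.exp (2 * (Real.pi : ℂ) * Complex.I *
          (((q : ℕ) : ℂ) * (n : ℂ) / (P : ℂ) + (σ : ℂ) * (l : ℂ))) else 0 := by
    simp_rw [mul_assoc (1 / (P : ℂ)), Finset.sum_mul, mul_assoc (autocorr μ x _ _), hsplit]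
    rw [← Finset.mul_sum, Finset.sum_comm, Finset.mul_sum]
    refine Finset.sum_congr rfl fun n _ => ?_
    rw [← Finset.mul_sum, ← Finset.mul_sum, sum_exp_eq_ite_dvd hP]
    split_ifs
    · field_simp
    · simp
  have h0 : 0 ≤ l % P := Int.emod_nonneg _ hPZ
  have hlt : l % P < P := Int.emod_lt_of_pos _ (by exact_mod_cast hP)
  have hn : (((l % P).toNat : ℕ) : ℤ) = l % P := Int.toNat_of_nonneg h0
  have hdvd : (P : ℤ) ∣ l - ((l % P).toNat : ℕ) := by
    rw [hn]
    exact Int.dvd_self_sub_emod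
  rw [hswap, Finset.sum_eq_single (l % P).toNat, if_pos hdvd, hx.eq_of_dvd hdvd]
  · congr 1
    obtain ⟨d, hd⟩ := hdvd
    have hl : (l : ℂ) = (P : ℂ) * d + ((l % P).toNat : ℂ) := by
      have : l = P * d + ((l % P).toNat : ℕ) := by rw [← hd]; ring
      exact_mod_cast congrArg (Int.cast : ℤ → ℂ) this
    rw [expo, Complex.exp_eq_exp_iff_exists_int]
    -- With `l = P d + n`, the phases `q l / P` and `q n / P` differ by the integer `q d`.
    refine ⟨(q : ℕ) * d, ?_⟩
    push_cast
    have h2 : ((q : ℕ) : ℂ) / P * (l : ℂ) =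
        (q : ℕ) * d + ((q : ℕ) : ℂ) * ((l % P).toNat : ℂ) / P := by
      rw [hl]
      field_simp
    linear_combination (2 * (Real.pi : ℂ) * Complex.I) * h2
  · intro n hnr hne
    rw [if_neg]
    intro hd
    refine hne ?_
    have h3 : (P : ℤ) ∣ (n : ℤ) - ((l % P).toNat : ℕ) := by
      rw [← sub_sub_sub_cancel_left _ _ l]
      exact dvd_sub hdvd hd
    have h4 := Finset.mem_range.1 hnr
    have h5 := Int.eq_zero_of_abs_lt_dvd h3 (by rw [abs_lt]; omega)
    omega
  · intro h
    exact absurd (Finset.mem_range.2 (by omega)) h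

end Cyclostationary

end CycloKL

namespace CycloKL

/-! ### Eigenfunctions, spectrum and orthogonal increments -/

section Cyclostationary

variable {Ω : Type*} [MeasurableSpace Ω] {μ : Measure Ω} {x : ℤ → Ω → ℂ} {P : ℕ}
  {B : ℝ → Matrix (Fin P) (Fin P) ℂ} {s : Fin P → ℝ → ℝ}

/-- Within a fibre `σ`, the kernel acts on coefficient vectors over the bands as multiplication by
the cyclic PSD matrix. -/
theorem csBasis_eigen (hP : 0 < P) (hx : IsCyclostationary μ x P)
    (hR : ∀ n : ℤ, Summable fun m : ℤ => autocorr μ x n m)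
    (hBeig : ∀ σ ∈ Ico (0 : ℝ) (1 / P), ∀ p : Fin P,
      cyclicPSD μ x P σ *ᵥ (fun q => B σ q p) = (s p σ : ℂ) • fun q => B σ q p)
    {t : ℝ} (ht : t ∈ Ico (0 : ℝ) 1) (k : ℤ) :
    HasSum (fun l : ℤ => autocorr μ x l (k - l) * csBasis P B l t)
      (((joinBands P s t : ℝ) : ℂ) * csBasis P B k t) := by
  obtain ⟨p, σ, hσ, rfl⟩ := exists_band hP ht
  simp only [csBasis, joinBands_add_div hP _ hσ]
  have h1 : HasSum (fun l : ℤ => ∑ q, B σ q p *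
      (autocorr μ x l (k - l) * expo l (σ + ((q : ℕ) : ℝ) / P)))
      (∑ q, B σ q p * ∑ r, cyclicPSD μ x P σ r q * expo k (σ + ((r : ℕ) : ℝ) / P)) :=
    hasSum_sum fun q _ => (hasSum_autocorr_mul_expo hP hx hR σ q k).mul_left _
  convert h1 using 1
  · ext l
    rw [Finset.mul_sum]
    exact Finset.sum_congr rfl fun q _ => by ring
  · simp_rw [Finset.mul_sum]
    rw [Finset.sum_comm]
    refine Finset.sum_congr rfl fun r _ => ?_
    have h2 := congrFun (hBeig σ hσ p) r
    rw [Matrix.mulVec, dotProduct, Pi.smul_apply, smul_eq_mul] at h2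
    rw [← mul_assoc, ← h2, Finset.sum_mul]
    exact Finset.sum_congr rfl fun q _ => by ring

/-- A measurable expression of the eigenvalues of the cyclic PSD matrix. -/
theorem eigenvalue_eq_rayleigh
    (hBunit : ∀ σ ∈ Ico (0 : ℝ) (1 / P), B σ ∈ Matrix.unitaryGroup (Fin P) ℂ)
    (hBeig : ∀ σ ∈ Ico (0 : ℝ) (1 / P), ∀ p : Fin P,
      cyclicPSD μ x P σ *ᵥ (fun q => B σ q p) = (s p σ : ℂ) • fun q => B σ q p)
    {σ : ℝ} (hσ : σ ∈ Ico (0 : ℝ) (1 / P)) (p : Fin P) :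
    s p σ = (∑ r, conj (B σ r p) * ∑ q, cyclicPSD μ x P σ r q * B σ q p).re := by
  have h2 : ∀ r, ∑ q, cyclicPSD μ x P σ r q * B σ q p = s p σ * B σ r p := by
    intro r
    have h := congrFun (hBeig σ hσ p) r
    rwa [Matrix.mulVec, dotProduct, Pi.smul_apply, smul_eq_mul] at h
  have h3 : ∑ r, conj (B σ r p) * ∑ q, cyclicPSD μ x P σ r q * B σ q p = s p σ := by
    simp_rw [h2]
    have h4 := sum_conj_mul_of_mem_unitary (hBunit σ hσ) p p
    rw [if_pos rfl] at h4
    refine Eq.trans ?_ (mul_one (s p σ : ℂ))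
    rw [← h4, Finset.mul_sum]
    exact Finset.sum_congr rfl fun q _ => by ring
  rw [h3, Complex.ofReal_re]

/-- The functions `s p` are not assumed measurable; on the band they equal Rayleigh quotients, built
from the measurable `B` and the continuous cyclic spectra. -/
theorem measurable_joinBands_eigenvalue
    (hR : ∀ n : ℤ, Summable fun m : ℤ => autocorr μ x n m)
    (hBmeas : ∀ q p : Fin P, Measurable fun σ => B σ q p)
    (hBunit : ∀ σ ∈ Ico (0 : ℝ) (1 / P), B σ ∈ Matrix.unitaryGroup (Fin P) ℂ)
    (hBeig : ∀ σ ∈ Ico (0 : ℝ) (1 / P), ∀ p : Fin P,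
      cyclicPSD μ x P σ *ᵥ (fun q => B σ q p) = (s p σ : ℂ) • fun q => B σ q p) :
    Measurable (joinBands P s) := by
  have h : joinBands P s = joinBands P fun p σ =>
      (∑ r, conj (B σ r p) * ∑ q, cyclicPSD μ x P σ r q * B σ q p).re := by
    ext t
    refine Finset.sum_congr rfl fun p _ => ?_
    by_cases ht : t ∈ Ico (((p : ℕ) : ℝ) / P) ((((p : ℕ) : ℝ) + 1) / P)
    · rw [indicator_of_mem ht, indicator_of_mem ht]
      refine eigenvalue_eq_rayleigh hBunit hBeig ?_ p
      rw [← preimage_add_div_band p, mem_preimage, sub_add_cancel]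
      exact ht
    · rw [indicator_of_notMem ht, indicator_of_notMem ht]
  rw [h]
  refine measurable_joinBands fun p => Complex.measurable_re.comp ?_
  refine Finset.measurable_sum _ fun r _ => Measurable.mul ?_ ?_
  · exact Complex.continuous_conj.measurable.comp (hBmeas r p)
  · refine Finset.measurable_sum _ fun q _ => Measurable.mul ?_ (hBmeas q p)
    exact (continuous_cyclicSpectrum hR _).measurable.comp (measurable_id.add_const _)

theorem exists_norm_joinBands_eigenvalue_le (hP : 0 < P)
    (hR : ∀ n : ℤ, Summable fun m : ℤ => autocorr μ x n m)
    (hBunit : ∀ σ ∈ Ico (0 : ℝ) (1 / P), B σ ∈ Matrix.unitaryGroup (Fin P) ℂ)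
    (hBeig : ∀ σ ∈ Ico (0 : ℝ) (1 / P), ∀ p : Fin P,
      cyclicPSD μ x P σ *ᵥ (fun q => B σ q p) = (s p σ : ℂ) • fun q => B σ q p) :
    ∃ C : ℝ, ∀ t, ‖joinBands P s t‖ ≤ C := by
  refine ⟨∑ r : Fin P, ∑ q : Fin P, ∑ i ∈ Finset.range P, ∑' m, ‖autocorr μ x (i : ℤ) m‖,
    norm_joinBands_le hP fun σ hσ p => ?_⟩
  rw [eigenvalue_eq_rayleigh hBunit hBeig hσ p]
  refine (Complex.abs_re_le_norm _).trans ((norm_sum_le _ _).trans ?_)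
  refine Finset.sum_le_sum fun r _ => ?_
  rw [norm_mul, RCLike.norm_conj]
  refine (mul_le_of_le_one_left (norm_nonneg _) (norm_entry_le_one hBunit hσ r p)).trans ?_
  refine (norm_sum_le _ _).trans (Finset.sum_le_sum fun q _ => ?_)
  rw [norm_mul]
  exact (mul_le_of_le_one_right (norm_nonneg _) (norm_entry_le_one hBunit hσ q p)).trans
    (norm_cyclicSpectrum_le hP hR _ _)

/-- Orthogonality of the increments of the spectral process of a bounded Karhunen-Loève basis
with a bounded spectrum. -/
theorem inner_eq_setIntegral_spectrum (hx : ∀ n, MemLp (x n) 2 μ)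
    (hR : ∀ n : ℤ, Summable fun m : ℤ => autocorr μ x n m) {φ : ℤ → ℝ → ℂ} {S : ℝ → ℝ}
    (hφ : IsKLBasis (autocorr μ x) φ S) (hφm : ∀ n, Measurable (φ n)) {D : ℝ}
    (hD : ∀ n t, ‖φ n t‖ ≤ D) (hSm : Measurable S) {C : ℝ} (hC : ∀ t, ‖S t‖ ≤ C)
    {ξ : Set ℝ → Lp ℂ 2 μ}
    (hξ : ∀ A, MeasurableSet A → A ⊆ Ico 0 1 →
      HasSum (fun n => (∫ t in A, conj (φ n t)) • toL2 hx n) (ξ A))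
    {A A' : Set ℝ} (hA : MeasurableSet A) (hA' : MeasurableSet A') (hA1 : A ⊆ Ico 0 1)
    (hA1' : A' ⊆ Ico 0 1) :
    inner ℂ (ξ A') (ξ A) = ∫ t in A ∩ A', (S t : ℂ) := by
  have hvol : volume A' ≠ ∞ := ((measure_mono hA1').trans_lt (by simp)).ne
  have hint : ∀ l, IntegrableOn (φ l) A' := fun l =>
    Measure.integrableOn_of_bounded hvol (hφm l).aestronglyMeasurable (M := D)
      (ae_of_all _ (hD l))
  -- `E[x(k) ξ(A')*]` comes from expanding `ξ(A')`, exchanging sum and integral by absolute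
  -- summability, and applying the eigenequation under the integral.
  have hk : ∀ k, inner ℂ (ξ A') (toL2 hx k) = ∫ t in A', (S t : ℂ) * φ k t := by
    intro k
    have h1 : HasSum (fun l => ∫ t in A', autocorr μ x l (k - l) * φ l t)
        (inner ℂ (ξ A') (toL2 hx k)) := by
      have h2 := ((hξ A' hA' hA1').mapL (innerSL ℂ (toL2 hx k))).map
        (starRingEnd ℂ) Complex.continuous_conj
      convert h2 using 1
      · ext l
        simp only [Function.comp_apply, innerSL_apply_apply]
        rw [inner_conj_symm, inner_smul_left, inner_toL2, ← integral_conj, integral_const_mul,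
          mul_comm]
        simp
      · simp
    have h3 : HasSum (fun l => ∫ t in A', autocorr μ x l (k - l) * φ l t)
        (∫ t in A', ∑' l, autocorr μ x l (k - l) * φ l t) := by
      refine hasSum_integral_of_summable_integral_norm (fun l => (hint l).const_mul _) ?_
      have hs : Summable fun l => ‖autocorr μ x l (k - l)‖ := by
        simp_rw [← inner_toL2 hx, norm_inner_symm _ (toL2 hx k)]
        exact summable_norm_inner_toL2 hx hR k
      refine Summable.of_nonneg_of_le (fun l => integral_nonneg fun t => norm_nonneg _)
        (fun l => ?_) (hs.mul_right (D * volume.real A'))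
      have := norm_setIntegral_le_of_norm_le_const (μ := volume) (s := A')
        (f := fun t => ‖autocorr μ x l (k - l) * φ l t‖)
        (C := ‖autocorr μ x l (k - l)‖ * D) hvol.lt_top fun t _ => by
          rw [norm_norm, norm_mul]
          exact mul_le_mul_of_nonneg_left (hD l t) (norm_nonneg _)
      rw [← mul_assoc]
      exact (le_abs_self _).trans this
    rw [h1.unique h3]
    exact setIntegral_congr_fun hA' fun t ht => (hφ.eigen t (hA1' ht) k).tsum_eq
  have h1 : HasSum (fun k => (∫ t in A, conj (φ k t)) * ∫ t in A', (S t : ℂ) * φ k t)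
      (inner ℂ (ξ A') (ξ A)) := by
    have h2 := (hξ A hA hA1).mapL (innerSL ℂ (ξ A'))
    refine h2.congr_fun fun k => ?_
    rw [innerSL_apply_apply, inner_smul_right, hk]
  have hgm : MemLp (A'.indicator fun t => (S t : ℂ)) 2 (volume.restrict (Ico (0 : ℝ) 1)) :=
    memLp_indicator_of_bound _ (Complex.measurable_ofReal.comp hSm) hA' (C := C) fun t _ => by
      simpa using hC t
  have hhm : MemLp (A.indicator fun _ => (1 : ℂ)) 2 (volume.restrict (Ico (0 : ℝ) 1)) :=
    memLp_indicator_of_bound _ measurable_const hA (C := 1) fun t _ => by simp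
  -- Parseval's identity with test functions `S 1_{A'}` and `1_A` sums the series `h1`.
  have h4 := hφ.complete _ _ hgm hhm
  have hind : ∀ (E : Set ℝ), MeasurableSet E → E ⊆ Ico 0 1 → ∀ f : ℝ → ℂ,
      ∫ t in Ico (0 : ℝ) 1, E.indicator f t = ∫ t in E, f t := by
    intro E hE hE1 f
    rw [setIntegral_indicator hE, inter_eq_right.2 hE1]
  have e1 : ∀ k, ∫ t in Ico (0 : ℝ) 1, conj (A'.indicator (fun t => (S t : ℂ)) t) * φ k t =
      ∫ t in A', (S t : ℂ) * φ k t := by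
    intro k
    rw [← hind A' hA' hA1']
    congr 1
    ext t
    by_cases ht : t ∈ A' <;> simp [ht]
  have e2 : ∀ k, ∫ t in Ico (0 : ℝ) 1, conj (φ k t) * A.indicator (fun _ => (1 : ℂ)) t =
      ∫ t in A, conj (φ k t) := by
    intro k
    rw [← hind A hA hA1]
    congr 1
    ext t
    by_cases ht : t ∈ A <;> simp [ht]
  have e3 : ∫ t in Ico (0 : ℝ) 1, conj (A'.indicator (fun t => (S t : ℂ)) t) *
      A.indicator (fun _ => (1 : ℂ)) t = ∫ t in A ∩ A', (S t : ℂ) := by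
    rw [← hind (A ∩ A') (hA.inter hA') (inter_subset_left.trans hA1)]
    congr 1
    ext t
    by_cases ht : t ∈ A <;> by_cases ht' : t ∈ A' <;> simp [ht, ht']
  simp_rw [e1, e2, e3] at h4
  refine h1.unique ?_
  simpa only [mul_comm] using h4

end Cyclostationary

/-! ### Integrals against translated measures -/

section Translation

variable {H : Type*} [NormedAddCommGroup H] [NormedSpace ℂ H]

theorem simpleIntegral_map_sub (η : VectorMeasure ℝ H) (c : ℝ) {A : Set ℝ} (hA : MeasurableSet A)
    (s : SimpleFunc ℝ ℂ) :
    simpleIntegral (η.map fun t => t - c) A s =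
      simpleIntegral η ((fun t => t - c) ⁻¹' A) (s.comp (fun t => t - c)
        (measurable_id.sub_const c)) := by
  unfold simpleIntegral
  have hr : (s.comp (fun t => t - c) (measurable_id.sub_const c)).range = s.range := by
    ext z
    simp only [SimpleFunc.mem_range, SimpleFunc.coe_comp]
    rw [(Function.Surjective.range_comp fun t => ⟨t + c, add_sub_cancel_right t c⟩)]
  rw [hr]
  refine Finset.sum_congr rfl fun z _ => ?_
  rw [VectorMeasure.map_apply _ (f := fun t => t - c) (measurable_id.sub_const c)
    (hA.inter (s.measurableSet_fiber z))]
  rfl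

theorem HasIntegral.map_sub {η : VectorMeasure ℝ H} {c : ℝ} {A : Set ℝ} (hA : MeasurableSet A)
    {f : ℝ → ℂ} {y : H}
    (h : HasIntegral η ((fun t => t - c) ⁻¹' A) (fun t => f (t - c)) y) :
    HasIntegral (η.map fun t => t - c) A f y := by
  refine ⟨fun δ hδ => ?_, fun ε hε => ?_⟩
  · obtain ⟨s, hs⟩ := h.1 δ hδ
    refine ⟨s.comp (fun t => t + c) (measurable_id.add_const c), fun t ht => ?_⟩
    simpa using hs (t + c) (by simpa using ht)
  · obtain ⟨δ, hδ, hs⟩ := h.2 ε hε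
    refine ⟨δ, hδ, fun s hsf => ?_⟩
    rw [simpleIntegral_map_sub η c hA]
    exact hs _ fun t ht => hsf (t - c) ht

end Translation

end CycloKL

namespace CycloKL

/-! ### The two expansions and their relation -/

section Cyclostationary

variable {Ω : Type*} [MeasurableSpace Ω] {μ : Measure Ω} {x : ℤ → Ω → ℂ} {P : ℕ}
  {B : ℝ → Matrix (Fin P) (Fin P) ℂ} {s : Fin P → ℝ → ℝ}

/-- The series for `Φ` is kept for all of L², since the relation to `ξ` integrates entries of `B`
against the measure, not only indicators. -/
theorem exists_isCLExpansion (hP : 0 < P) (hx : IsCyclostationary μ x P)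
    (hR : ∀ n : ℤ, Summable fun m : ℤ => autocorr μ x n m) :
    ∃ Φ : Lp ℂ 2 (volume.restrict (Ico (0 : ℝ) 1)) →L[ℂ] Lp ℂ 2 μ,
      (∀ (g : ℝ → ℂ) (hg : MemLp g 2 (volume.restrict (Ico (0 : ℝ) 1))),
        HasSum (fun n => (∫ t in Ico (0 : ℝ) 1, conj (expo n t) * g t) • toL2 hx.secondOrder n)
          (Φ (hg.toLp g))) ∧
      IsCLExpansion hx.secondOrder (ofL2 _ Φ) := by
  have hm : ∀ n, MemLp (expo n) 2 (volume.restrict (Ico (0 : ℝ) 1)) := fun n =>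
    MemLp.of_bound (measurable_expo n).aestronglyMeasurable 1
      (ae_of_all _ fun t => (norm_expo n t).le)
  obtain ⟨b, hb⟩ := exists_hilbertBasis _ hm expo_orthonormal expo_complete
  obtain ⟨Φ, hΦ, hsp⟩ := exists_isSpectralProcess (sum_norm_inner_toL2_le hP hx hR) measurable_expo
    (fun n t => (norm_expo n t).le) hm b hb
  refine ⟨Φ, fun g hg => ?_, hsp⟩
  have h := hΦ (hg.toLp g)
  simp_rw [hb, inner_toLp] at h
  exact h

theorem isKLBasis_csBasis (hP : 0 < P) (hx : IsCyclostationary μ x P)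
    (hR : ∀ n : ℤ, Summable fun m : ℤ => autocorr μ x n m)
    (hBmeas : ∀ q p : Fin P, Measurable fun σ => B σ q p)
    (hBunit : ∀ σ ∈ Ico (0 : ℝ) (1 / P), B σ ∈ Matrix.unitaryGroup (Fin P) ℂ)
    (hBeig : ∀ σ ∈ Ico (0 : ℝ) (1 / P), ∀ p : Fin P,
      cyclicPSD μ x P σ *ᵥ (fun q => B σ q p) = (s p σ : ℂ) • fun q => B σ q p) :
    IsKLBasis (autocorr μ x) (csBasis P B) (joinBands P s) where
  memLp := memLp_csBasis hP hBmeas hBunit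
  orthonormal := csBasis_orthonormal hP hBmeas hBunit
  complete := csBasis_complete hP hBmeas hBunit
  eigen _ ht k := csBasis_eigen hP hx hR hBeig ht k

theorem exists_isKLExpansion (hP : 0 < P) (hx : IsCyclostationary μ x P)
    (hR : ∀ n : ℤ, Summable fun m : ℤ => autocorr μ x n m)
    (hBmeas : ∀ q p : Fin P, Measurable fun σ => B σ q p)
    (hBunit : ∀ σ ∈ Ico (0 : ℝ) (1 / P), B σ ∈ Matrix.unitaryGroup (Fin P) ℂ)
    (hBeig : ∀ σ ∈ Ico (0 : ℝ) (1 / P), ∀ p : Fin P,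
      cyclicPSD μ x P σ *ᵥ (fun q => B σ q p) = (s p σ : ℂ) • fun q => B σ q p) :
    ∃ ξ : VectorMeasure ℝ (Lp ℂ 2 μ),
      (∀ A, MeasurableSet A → A ⊆ Ico 0 1 →
        HasSum (fun n => (∫ t in A, conj (csBasis P B n t)) • toL2 hx.secondOrder n) (ξ A)) ∧
      IsKLExpansion hx.secondOrder (csBasis P B) (joinBands P s) ξ := by
  have hbasis := isKLBasis_csBasis hP hx hR hBmeas hBunit hBeig
  obtain ⟨b, hb⟩ := exists_hilbertBasis _ hbasis.memLp hbasis.orthonormal hbasis.complete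
  obtain ⟨Φ, hΦ, hsp⟩ := exists_isSpectralProcess (sum_norm_inner_toL2_le hP hx hR)
    (measurable_csBasis hBmeas) (norm_csBasis_le hP hBunit) hbasis.memLp b hb
  have hξ : ∀ A, MeasurableSet A → A ⊆ Ico 0 1 →
      HasSum (fun n => (∫ t in A, conj (csBasis P B n t)) • toL2 hx.secondOrder n)
        (ofL2 (volume.restrict (Ico (0 : ℝ) 1)) Φ A) := by
    intro A hA hA1
    rw [ofL2_apply _ Φ hA]
    refine (hΦ _).congr_fun fun n => ?_
    rw [hb, inner_toLp_indL2, setIntegral_restrict_Ico hA hA1]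
  have hSm := measurable_joinBands_eigenvalue hR hBmeas hBunit hBeig
  obtain ⟨C, hC⟩ := exists_norm_joinBands_eigenvalue_le hP hR hBunit hBeig
  refine ⟨_, hξ, hbasis, hsp, ?_, fun A A' hA hA' hA1 hA1' => ?_⟩
  · exact Measure.integrableOn_of_bounded (by simp) hSm.aestronglyMeasurable (ae_of_all _ hC)
  · rw [← inner_eq_setIntegral_spectrum hx.secondOrder hR hbasis (measurable_csBasis hBmeas)
      (norm_csBasis_le hP hBunit) hSm hC hξ hA hA' hA1 hA1', L2.inner_def]
    rfl

theorem preimage_sub_subset_Ico (hP : 0 < P) {A : Set ℝ} (hA : A ⊆ Ico (0 : ℝ) (1 / P))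
    (p : Fin P) : (fun t : ℝ => t - ((p : ℕ) : ℝ) / P) ⁻¹' A ⊆ Ico 0 1 := by
  intro t ht
  simpa using add_div_mem_Ico hP (hA ht) p

theorem setIntegral_preimage_sub (c : ℝ) (A : Set ℝ) (f : ℝ → ℂ) :
    ∫ t in (fun t : ℝ => t - c) ⁻¹' A, f t = ∫ σ in A, f (σ + c) := by
  have h := (measurePreserving_sub_right volume c).setIntegral_preimage_emb
    (measurableEmbedding_subRight c) (fun σ => f (σ + c)) A
  simpa using h

/-- The integral of `conj b^{(p)}(q)` over band `q` is `Φ` of that function supported on the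
translate of `A` by `q/P`. Summed over `q`, the coefficient of `x n` is the integral of `conj (φ n)`
over the translate by `p/P`, which is its coefficient in `ξ^{(p)}(A)`. -/
theorem incrementsEq_band (hP : 0 < P) (hx : ∀ n, MemLp (x n) 2 μ)
    (hBmeas : ∀ q p : Fin P, Measurable fun σ => B σ q p)
    (hBunit : ∀ σ ∈ Ico (0 : ℝ) (1 / P), B σ ∈ Matrix.unitaryGroup (Fin P) ℂ)
    {Φ : Lp ℂ 2 (volume.restrict (Ico (0 : ℝ) 1)) →L[ℂ] Lp ℂ 2 μ}
    (hΦ : ∀ (g : ℝ → ℂ) (hg : MemLp g 2 (volume.restrict (Ico (0 : ℝ) 1))),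
        HasSum (fun n => (∫ t in Ico (0 : ℝ) 1, conj (expo n t) * g t) • toL2 hx n)
          (Φ (hg.toLp g)))
    {ξ : VectorMeasure ℝ (Lp ℂ 2 μ)}
    (hξ : ∀ A, MeasurableSet A → A ⊆ Ico 0 1 →
        HasSum (fun n => (∫ t in A, conj (csBasis P B n t)) • toL2 hx n) (ξ A)) :
    IncrementsEq (Ico 0 (1 / (P : ℝ))) (band P ξ) (fun σ => (B σ)ᴴ)
      (band P (ofL2 _ Φ)) := by
  intro p A hA hA1
  let E : Fin P → Set ℝ := fun q => (fun t : ℝ => t - ((q : ℕ) : ℝ) / P) ⁻¹' A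
  have hE : ∀ q, MeasurableSet (E q) := fun q => measurable_id.sub_const _ hA
  have hE1 : ∀ q, E q ⊆ Ico 0 1 := preimage_sub_subset_Ico hP hA1
  have hm : ∀ q, Measurable fun σ => conj (B σ q p) := fun q =>
    Complex.continuous_conj.measurable.comp (hBmeas q p)
  have hfm : ∀ q : Fin P, Measurable fun t : ℝ => conj (B (t - ((q : ℕ) : ℝ) / P) q p) := fun q =>
    (hm q).comp (measurable_id.sub_const _)
  have hf1 : ∀ q : Fin P, ∀ t ∈ E q, ‖conj (B (t - ((q : ℕ) : ℝ) / P) q p)‖ ≤ 1 := by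
    intro q t ht
    rw [RCLike.norm_conj]
    exact norm_entry_le_one hBunit (hA1 ht) q p
  have hF := fun q : Fin P => memLp_indicator_of_bound (volume.restrict (Ico (0 : ℝ) 1))
    (hfm q) (hE q) (hf1 q)
  refine ⟨fun q => Φ ((hF q).toLp _), fun q => ?_, ?_⟩
  · exact HasIntegral.map_sub hA (hasIntegral_ofL2 _ Φ (hE q) (hfm q) (hf1 q) (hF q))
  · have h1 := hasSum_sum (s := Finset.univ) fun q (_ : q ∈ Finset.univ) => hΦ _ (hF q)
    have h2 : band P ξ p A = ξ (E p) :=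
      VectorMeasure.map_apply _ (f := fun t => t - ((p : ℕ) : ℝ) / P)
        (measurable_id.sub_const _) hA
    rw [h2]
    refine (hξ (E p) (hE p) (hE1 p)).unique (h1.congr_fun fun n => ?_)
    rw [← Finset.sum_smul]
    congr 1
    have hvol : volume A ≠ ∞ := ((measure_mono hA1).trans_lt (by simp)).ne
    have h3 : ∀ q, ∫ t in Ico (0 : ℝ) 1, conj (expo n t) *
        (E q).indicator (fun t => conj (B (t - ((q : ℕ) : ℝ) / P) q p)) t =
        ∫ σ in A, conj (expo n (σ + ((q : ℕ) : ℝ) / P)) * conj (B σ q p) := by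
      intro q
      simp_rw [← indicator_mul_right (E q) fun t => conj (expo n t)]
      rw [setIntegral_indicator (hE q), inter_eq_right.2 (hE1 q), setIntegral_preimage_sub]
      simp only [add_sub_cancel_right]
    simp_rw [h3]
    rw [setIntegral_preimage_sub, ← integral_finsetSum]
    · refine setIntegral_congr_fun hA fun σ hσ => ?_
      simp only [csBasis, joinBands_add_div hP _ (hA1 hσ), map_sum, map_mul]
      exact Finset.sum_congr rfl fun q _ => mul_comm _ _
    · intro q _
      refine Measure.integrableOn_of_bounded (M := 1) hvol (Measurable.aestronglyMeasurable ?_) ?_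
      · exact (Complex.continuous_conj.measurable.comp
          ((measurable_expo n).comp (measurable_id.add_const _))).mul (hm q)
      · refine (ae_restrict_mem hA).mono fun σ hσ => ?_
        rw [norm_mul, RCLike.norm_conj, RCLike.norm_conj, norm_expo, one_mul]
        exact norm_entry_le_one hBunit (hA1 hσ) q p

end Cyclostationary

end CycloKL

theorem corollary1 {Ω : Type*} [MeasurableSpace Ω] (μ : Measure Ω) [IsProbabilityMeasure μ]
    (P : ℕ) (hP : 0 < P) (x : ℤ → Ω → ℂ) (hx : CycloKL.IsCyclostationary μ x P)
    (hR : ∀ n : ℤ, Summable fun m : ℤ => CycloKL.autocorr μ x n m)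
    (B : ℝ → Matrix (Fin P) (Fin P) ℂ) (s : Fin P → ℝ → ℝ)
    (hBmeas : ∀ q p : Fin P, Measurable fun σ => B σ q p)
    (hBunit : ∀ σ ∈ Ico (0 : ℝ) (1 / P), B σ ∈ Matrix.unitaryGroup (Fin P) ℂ)
    (hBeig : ∀ σ ∈ Ico (0 : ℝ) (1 / P), ∀ p : Fin P,
      CycloKL.cyclicPSD μ x P σ *ᵥ (fun q => B σ q p) = (s p σ : ℂ) • fun q => B σ q p) :
    (∃! ν : VectorMeasure ℝ (Lp ℂ 2 μ), CycloKL.IsCLExpansion hx.secondOrder ν) ∧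
    (∃! ξ : VectorMeasure ℝ (Lp ℂ 2 μ), CycloKL.IsKLExpansion hx.secondOrder
      (CycloKL.csBasis P B) (CycloKL.joinBands P s) ξ) ∧
    ∀ ν ξ : VectorMeasure ℝ (Lp ℂ 2 μ),
      CycloKL.IsCLExpansion hx.secondOrder ν →
      CycloKL.IsKLExpansion hx.secondOrder (CycloKL.csBasis P B) (CycloKL.joinBands P s) ξ →
      CycloKL.IncrementsEq (Ico 0 (1 / (P : ℝ))) (CycloKL.band P ξ) (fun σ => (B σ)ᴴ)
        (CycloKL.band P ν) := by
  obtain ⟨Φ, hΦ, hν⟩ := CycloKL.exists_isCLExpansion hP hx hR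
  obtain ⟨ξ₀, hξ₀, hξ⟩ := CycloKL.exists_isKLExpansion hP hx hR hBmeas hBunit hBeig
  refine ⟨⟨_, hν, fun ν h => CycloKL.IsSpectralProcess.unique h hν⟩,
    ⟨ξ₀, hξ, fun ξ h => h.spectral.unique hξ.spectral⟩, fun ν ξ h h' => ?_⟩
  -- By uniqueness it suffices to treat the constructed processes, whose series are explicit.
  rw [CycloKL.IsSpectralProcess.unique h hν, h'.spectral.unique hξ.spectral]
  exact CycloKL.incrementsEq_band hP hx.secondOrder hBmeas hBunit hΦ hξ₀
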